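/- Let $A = x\,dy\wedge dz + y\,dz\wedge dx + z\,dx\wedge dy$ be the area form of the unit sphere $S^2\subset\mathbb R^3$ (outward orientation), put $\omega_c=\frac c2 A$ for $c\in\mathbb R$, let $e^{i\varphi}\in S^1$ act on $S^2$ by the rotation $(x,y,z)\mapsto(x\cos\varphi-y\sin\varphi,\ x\sin\varphi+y\cos\varphi,\ z)$, and for integers $k,n$ let $$\Phi(x,y,z)=\tfrac n2(z+1)+k+\tfrac12 ,$$ a moment map for this action on $(S^2,\omega_n)$. Let $\omega_{\mathbb C}=-i\,dz\wedge d\bar z$ on $\mathbb C$. For $\alpha\in\mathbb R$ the cut spaces are $$(S^2)^{\pm}_{cut}=\{(m,u)\in S^2\times\mathbb C:\ \Phi(m)\mp|u|^2=\alpha\}/S^1 ,$$ where $a\in S^1$ acts by $a\cdot(m,u)=(a\cdot m,a^{\mp1}u)$. The reduced form $\omega_{cut}^{\pm}$ is the two-form on the cut space whose pullback to the level set is the restriction of $\omega_n\oplus\omega_{\mathbb C}$. The circle acts on the cut spaces by $a\cdot[m,u]=[a\cdot m,u]$. Let $k,n,\ell$ be integers and $\alpha=\ell/2$. (1) If $k+\frac12<\frac\ell2<n+k+\frac12$,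 then the level sets are embedded hypersurfaces, the cut spaces are smooth quotients of them, the reduced forms exist and are unique, and there are $S^1$-equivariant diffeomorphisms of the cut spaces with $S^2$ under which $$\omega_{cut}^+=\omega_{k+n+(1-\ell)/2},\qquad \omega_{cut}^-=\omega_{-k+(\ell-1)/2}.$$ (2) If $n+k+\frac12<\frac\ell2<k+\frac12$ (so $n<0$), the same holds with the two forms exchanged: $$\omega_{cut}^+=\omega_{-k+(\ell-1)/2},\qquad \omega_{cut}^-=\omega_{k+n+(1-\ell)/2}.$$ -/

import Mathlib

noncomputable section

open scoped Manifold ContDiff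

namespace SphereCut

/-! ### Two-forms on manifolds -/

section Forms

variable {E H M E' H' M' : Type*}
  [NormedAddCommGroup E] [NormedSpace ℝ E] [TopologicalSpace H]
  [TopologicalSpace M] [ChartedSpace H M]
  [NormedAddCommGroup E'] [NormedSpace ℝ E'] [TopologicalSpace H']
  [TopologicalSpace M'] [ChartedSpace H' M']

/-- A real two-form on a manifold: an alternating bilinear form on every tangent space. -/
abbrev TwoForm (I : ModelWithCorners ℝ E H) (M : Type*) [TopologicalSpace M]
    [ChartedSpace H M] : Type _ :=
  (x : M) → (TangentSpace I x) [⋀^Fin 2]→L[ℝ] ℝ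

/-- The pullback `f^* ω` of a two-form along a map. -/
def TwoForm.pullback {I : ModelWithCorners ℝ E H} {I' : ModelWithCorners ℝ E' H'}
    (f : M → M') (om : TwoForm I' M') : TwoForm I M :=
  fun x => (om (f x)).compContinuousLinearMap (mfderiv I I' f x)

end Forms

/-- The wedge product of two covectors, `(α ∧ β)(u, v) = α u * β v - α v * β u`. -/
def wedge {V : Type*} [NormedAddCommGroup V] [NormedSpace ℝ V] (α β : V →L[ℝ] ℝ) :
    V [⋀^Fin 2]→L[ℝ] ℝ where
  toFun v := α (v 0) * β (v 1) - α (v 1) * β (v 0)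
  map_update_add' := by
    intro _ m i x y
    fin_cases i <;> simp <;> ring
  map_update_smul' := by
    intro _ m i c x
    fin_cases i <;> simp <;> ring
  map_eq_zero_of_eq' := by
    intro v i j h hij
    fin_cases i <;> fin_cases j <;> simp_all
  cont := by fun_prop

/-- The form `-i dz ∧ dz̄` on the complex plane. Since `dz ∧ dz̄ = -2i dx ∧ dy`, this real
two-form equals `-2 dx ∧ dy`; see `omegaC_apply`. -/
def omegaC : TwoForm 𝓘(ℝ, ℂ) ℂ :=
  fun _ => (-2 : ℝ) • wedge Complex.reCLM Complex.imCLM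

theorem wedge_apply {V : Type*} [NormedAddCommGroup V] [NormedSpace ℝ V] (α β : V →L[ℝ] ℝ)
    (v : Fin 2 → V) : wedge α β v = α (v 0) * β (v 1) - α (v 1) * β (v 0) := rfl

/-- `omegaC` is the form `-i dz ∧ dz̄`. -/
theorem omegaC_apply (z u v : ℂ) :
    ((omegaC z ![u, v] : ℝ) : ℂ) =
      -Complex.I * (u * (starRingEnd ℂ) v - v * (starRingEnd ℂ) u) := by
  have h : omegaC z ![u, v] = (-2 : ℝ) * (u.re * v.im - v.re * u.im) := rfl
  rw [h]
  apply Complex.ext <;> simp <;> ring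

/-! ### Cutting a manifold with a circle action -/

section Cut

variable {d : ℕ} {M : Type*} [TopologicalSpace M]
  [ChartedSpace (EuclideanSpace ℝ (Fin d)) M] [MulAction Circle M]

/-- The form `ω ⊕ ω_ℂ` on `M × ℂ`. -/
def sumForm (om : TwoForm (𝓡 d) M) : TwoForm ((𝓡 d).prod 𝓘(ℝ, ℂ)) (M × ℂ) :=
  fun p =>
    TwoForm.pullback (I := (𝓡 d).prod 𝓘(ℝ, ℂ)) Prod.fst om p +
      TwoForm.pullback (I := (𝓡 d).prod 𝓘(ℝ, ℂ)) Prod.snd omegaC p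

/-- The level set `{(m, z) : Φ m - ε |z|² = α}` in `M × ℂ`; here `ε = 1` is used for the positive
and `ε = -1` for the negative cut space. -/
abbrev Level (Φ : M → ℝ) (α : ℝ) (ε : ℤˣ) : Type _ :=
  {p : M × ℂ // Φ p.1 - ((ε : ℤ) : ℝ) * ‖p.2‖ ^ 2 = α}

/-- The circle orbits in the level set for the action `a · (m, z) = (a · m, a ^ (-ε) z)`, that is,
for the anti-diagonal action if `ε = 1` and for the diagonal action if `ε = -1`. -/
def orbitSetoid (Φ : M → ℝ) (α : ℝ) (ε : ℤˣ) : Setoid (Level Φ α ε) where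
  r p q := ∃ a : Circle, q.1.1 = a • p.1.1 ∧ q.1.2 = ((a ^ (-(ε : ℤ)) : Circle) : ℂ) * p.1.2
  iseqv :=
    { refl := fun p => ⟨1, by simp, by simp⟩
      symm := by
        rintro p q ⟨a, h₁, h₂⟩
        refine ⟨a⁻¹, by simp [h₁], ?_⟩
        rw [h₂, ← mul_assoc, ← Circle.coe_mul, inv_zpow, inv_mul_cancel, Circle.coe_one, one_mul]
      trans := by
        rintro p q r ⟨a, h₁, h₂⟩ ⟨b, h₃, h₄⟩
        refine ⟨b * a, by rw [h₃, h₁, mul_smul], ?_⟩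
        rw [h₄, h₂, ← mul_assoc, ← Circle.coe_mul, mul_zpow] }

/-- The (positive or negative) cut space: the quotient of the level set by the circle action,
with the quotient topology. -/
abbrev CutSpace (Φ : M → ℝ) (α : ℝ) (ε : ℤˣ) : Type _ :=
  Quotient (orbitSetoid Φ α ε)

/-- The quotient map from the level set to the cut space. -/
def cutMk (Φ : M → ℝ) (α : ℝ) (ε : ℤˣ) (p : Level Φ α ε) : CutSpace Φ α ε :=
  Quotient.mk (orbitSetoid Φ α ε) p

/-- The smooth structures used in reduction: the level set is an embedded hypersurface of `M × ℂ`,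
and the cut space carries the quotient structure, i.e. the one for which the
quotient map is a submersion. -/
structure IsReductionStructure (Φ : M → ℝ) (α : ℝ) (ε : ℤˣ)
    [ChartedSpace (EuclideanSpace ℝ (Fin (d + 1))) (Level Φ α ε)]
    [ChartedSpace (EuclideanSpace ℝ (Fin d)) (CutSpace Φ α ε)] : Prop where
  level_manifold : IsManifold (𝓡 (d + 1)) ∞ (Level Φ α ε)
  cut_manifold : IsManifold (𝓡 d) ∞ (CutSpace Φ α ε)
  embedding : Manifold.IsSmoothEmbedding (𝓡 (d + 1)) ((𝓡 d).prod 𝓘(ℝ, ℂ)) ∞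
    (Subtype.val : Level Φ α ε → M × ℂ)
  submersion : Manifold.IsSubmersion (𝓡 (d + 1)) (𝓡 d) ∞ (cutMk Φ α ε)

/-- `η` is the reduced two-form `ω_cut` on the cut space: its pullback to the level set is
the restriction of `ω ⊕ ω_ℂ`. -/
def IsReducedForm (om : TwoForm (𝓡 d) M) (Φ : M → ℝ) (α : ℝ) (ε : ℤˣ)
    [ChartedSpace (EuclideanSpace ℝ (Fin (d + 1))) (Level Φ α ε)]
    [ChartedSpace (EuclideanSpace ℝ (Fin d)) (CutSpace Φ α ε)]
    (η : TwoForm (𝓡 d) (CutSpace Φ α ε)) : Prop :=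
  TwoForm.pullback (I := 𝓡 (d + 1)) (cutMk Φ α ε) η =
    TwoForm.pullback (I := 𝓡 (d + 1)) (Subtype.val : Level Φ α ε → M × ℂ) (sumForm om)

/-- The cut space of `(M, ω, Φ)` at level `α`, with its reduced form and residual circle action
`a · [m, z] = [a · m, z]`, is identified with `(N, σ)`: the smooth structures needed for reduction
exist, and for any of them there is an equivariant diffeomorphism `F` from
the cut space to `N` such that `F^* σ` is the reduced form and the only one. -/
def CutIdentifiedWith (om : TwoForm (𝓡 d) M) (Φ : M → ℝ) (α : ℝ) (ε : ℤˣ)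
    {N : Type*} [TopologicalSpace N] [ChartedSpace (EuclideanSpace ℝ (Fin d)) N]
    [MulAction Circle N] (σ : TwoForm (𝓡 d) N) : Prop :=
  (∃ (_ : ChartedSpace (EuclideanSpace ℝ (Fin (d + 1))) (Level Φ α ε))
      (_ : ChartedSpace (EuclideanSpace ℝ (Fin d)) (CutSpace Φ α ε)),
      IsReductionStructure (d := d) Φ α ε) ∧
  ∀ [ChartedSpace (EuclideanSpace ℝ (Fin (d + 1))) (Level Φ α ε)]
    [ChartedSpace (EuclideanSpace ℝ (Fin d)) (CutSpace Φ α ε)],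
    IsReductionStructure (d := d) Φ α ε →
    ∃ F : CutSpace Φ α ε ≃ₘ^∞⟮𝓡 d, 𝓡 d⟯ N,
      (∀ (a : Circle) (p q : Level Φ α ε), q.1.1 = a • p.1.1 → q.1.2 = p.1.2 →
        F (cutMk Φ α ε q) = a • F (cutMk Φ α ε p)) ∧
      ∀ η : TwoForm (𝓡 d) (CutSpace Φ α ε),
        IsReducedForm om Φ α ε η ↔ η = TwoForm.pullback F σ

end Cut

/-! ### The two-sphere -/

/-- Euclidean three-space. -/
abbrev E3 : Type := EuclideanSpace ℝ (Fin 3)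

/-- The unit sphere in three-space, with the smooth structure of Mathlib. -/
abbrev S2 : Type := Metric.sphere (0 : E3) 1

instance factFinrankE3 : Fact (Module.finrank ℝ E3 = 2 + 1) := ⟨by simp⟩

/-- The coordinate one-form `dx_i` on three-space. -/
def dx (i : Fin 3) : E3 →L[ℝ] ℝ := EuclideanSpace.proj i

/-- The form `x dy ∧ dz + y dz ∧ dx + z dx ∧ dy` on three-space. -/
def ambientAreaForm : TwoForm (𝓡 3) E3 :=
  fun p => p 0 • wedge (dx 1) (dx 2) + p 1 • wedge (dx 2) (dx 0) + p 2 • wedge (dx 0) (dx 1)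

/-- The area form `A` of the unit sphere, for the outward orientation. -/
def areaForm : TwoForm (𝓡 2) S2 :=
  TwoForm.pullback (Subtype.val : S2 → E3) ambientAreaForm

/-- The form `ω_c = (c / 2) A` on the sphere. -/
def omegaS2 (c : ℝ) : TwoForm (𝓡 2) S2 :=
  fun x => (c / 2) • areaForm x

/-- Rotation about the third axis by the angle of `a`: with `a = e^{iφ}` this is `v ↦ C_φ v`. -/
def rot (a : Circle) (v : E3) : E3 :=
  !₂[(a : ℂ).re * v 0 - (a : ℂ).im * v 1, (a : ℂ).im * v 0 + (a : ℂ).re * v 1, v 2]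

theorem rot_mem (a : Circle) (v : S2) : rot a v ∈ Metric.sphere (0 : E3) 1 := by
  have ha : (a : ℂ).re * (a : ℂ).re + (a : ℂ).im * (a : ℂ).im = 1 := by
    rw [← Complex.normSq_apply]; exact Circle.normSq_coe a
  have hv : ‖(v : E3)‖ ^ 2 = 1 := by rw [norm_eq_of_mem_sphere]; norm_num
  rw [mem_sphere_zero_iff_norm, ← sq_eq_sq₀ (norm_nonneg _) zero_le_one]
  rw [EuclideanSpace.norm_sq_eq, Fin.sum_univ_three] at hv ⊢
  simp only [Real.norm_eq_abs, sq_abs] at hv ⊢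
  simp [rot]
  linear_combination hv + ((v : E3) 0 ^ 2 + (v : E3) 1 ^ 2) * ha

/-- The circle acts on the sphere by rotations about the third axis. -/
instance instMulActionS2 : MulAction Circle S2 where
  smul a v := ⟨rot a v, rot_mem a v⟩
  one_smul v := by
    apply Subtype.ext
    change rot 1 v = v
    ext i
    fin_cases i <;> simp [rot]
  mul_smul a b v := by
    apply Subtype.ext
    change rot (a * b) v = rot a (rot b v)
    ext i
    fin_cases i <;> simp [rot] <;> ring

/-- The moment map `Φ(x) = (n / 2) (x₃ + 1) + k + 1 / 2` of the rotation action on `(S², ω_n)`. -/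
def moment (k n : ℤ) (v : S2) : ℝ :=
  (n : ℝ) / 2 * ((v : E3) 2 + 1) + k + 1 / 2

end SphereCut

end

noncomputable section

open scoped Manifold ContDiff Topology
open Set Function Module

/-! ### Immersions and submersions from their differentials -/

section InverseFunction

variable {E F : Type*} [NormedAddCommGroup E] [NormedSpace ℝ E] [CompleteSpace E]
  [NormedAddCommGroup F] [NormedSpace ℝ F]

/-! The level equation says that |u|² is an affine function of the height z vanishing at the cutting
height. The level set therefore lies over a cap around one pole s = ±1. Let R in (0, 2) be the
height of the cap and K the maximum of |u|². By Archimedes, w = y₀ + i y₁ with z = s(1 − R|w|²) is a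
Darboux coordinate on the cap, in which A = 2sR dy₀ ∧ dy₁. Writing u = √K v, or its conjugate when ε
= −1, with v = y₂ + i y₃, turns the level equation into |w|² + |v|² = 1. So the level set is S³,
with the circle acting by (w, v) ↦ (aw, a⁻¹v). The orbits are the fibres of the Hopf map (w, v) ↦
(2wv, s(|v|² − |w|²)), and the residual action w ↦ aw becomes rotation by a.

On S³ the Hopf map pulls A back to 4s(dy₀ ∧ dy₁ − dy₂ ∧ dy₃), while ω_n ⊕ ω_ℂ becomes nsR dy₀ ∧ dy₁
− 2εK dy₂ ∧ dy₃. The moment map gives K = εnsR/2, so the two are proportional and the reduced form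
is ω_{nR/2} (`pullback_cap_sumForm`).

The identification must work for every admissible smooth structure. The embedding makes the
bijection with S³ a diffeomorphism, local sections of submersions (`contMDiff_of_comp`) do the same
for the cut space and S², and `TwoForm.pullback_injective` gives uniqueness. Existence transports
the structures of S³ and S²; the local normal forms of the inclusion and of the quotient map then
come from the inverse function theorem. -/

/-- The inverse function theorem, with an inverse that is smooth on the whole target. -/
theorem ContDiffOn.exists_openPartialHomeomorph {n : ℕ∞ω} (hn : n ≠ 0) {f : E → F} {U : Set E}
    (hU : IsOpen U) (hf : ContDiffOn ℝ n f U) {a : E} (ha : a ∈ U) {f' : E ≃L[ℝ] F}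
    (hf' : HasFDerivAt f (f' : E →L[ℝ] F) a) :
    ∃ Θ : OpenPartialHomeomorph E F, a ∈ Θ.source ∧ (∀ x, Θ x = f x) ∧
      ContDiffOn ℝ n Θ Θ.source ∧ ContDiffOn ℝ n Θ.symm Θ.target := by
  have hat : ∀ x ∈ U, ContDiffAt ℝ n f x := fun x hx => hf.contDiffAt (hU.mem_nhds hx)
  -- Invertibility of the derivative is an open condition; restricting to it makes the inverse
  -- smooth on the whole target.
  set V : Set E := U ∩ fderiv ℝ f ⁻¹' range ((↑) : (E ≃L[ℝ] F) → E →L[ℝ] F)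
  have hVo : IsOpen V :=
    (hf.continuousOn_fderiv_of_isOpen hU
      (ENat.one_le_iff_ne_zero_withTop.2 hn)).isOpen_inter_preimage hU (ContinuousLinearEquiv.isOpen (𝕜 := ℝ) (E := E) (F := F))
  set Θ₀ := (hat a ha).toOpenPartialHomeomorph f hf' hn
  refine ⟨Θ₀.restrOpen V hVo, ⟨(hat a ha).mem_toOpenPartialHomeomorph_source hf' hn, ha,
    ⟨f', hf'.fderiv.symm⟩⟩, fun x => rfl, fun x hx => ?_, fun y hy => ?_⟩
  · exact ((hat x hx.2.1).contDiffWithinAt)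
  · have hx := (Θ₀.restrOpen V hVo).map_target hy
    obtain ⟨-, hxU, g', hg'⟩ := hx
    refine ContDiffAt.contDiffWithinAt
      ((Θ₀.restrOpen V hVo).contDiffAt_symm (f₀' := g') hy ?_ (hat _ hxU))
    rw [hg']
    exact ((hat _ hxU).differentiableAt hn).hasFDerivAt

end InverseFunction

section Charts

variable {E H M : Type*} [NormedAddCommGroup E] [NormedSpace ℝ E] [TopologicalSpace H]
  [TopologicalSpace M] [ChartedSpace H M] (I : ModelWithCorners ℝ E H) [I.Boundaryless]

/-- The preferred chart at `x`, followed by a local homeomorphism of the model vector space. -/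
def chartTrans (x : M) (Θ : OpenPartialHomeomorph E E) : OpenPartialHomeomorph M H :=
  ((chartAt H x).transHomeomorph I.toHomeomorph).trans Θ |>.transHomeomorph I.toHomeomorph.symm

variable {I}

theorem chartTrans_extend_apply (x : M) (Θ : OpenPartialHomeomorph E E) (y : M) :
    (chartTrans I x Θ).extend I y = Θ (extChartAt I x y) :=
  I.right_inv (I.range_eq_univ.symm ▸ mem_univ _)

theorem chartTrans_extend_symm_apply (x : M) (Θ : OpenPartialHomeomorph E E) (e : E) :
    ((chartTrans I x Θ).extend I).symm e = (extChartAt I x).symm (Θ.symm e) := by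
  change (extChartAt I x).symm (Θ.symm (I (I.symm e))) = _
  rw [I.right_inv (I.range_eq_univ.symm ▸ mem_univ _)]

theorem mem_chartTrans_extend_target {x : M} {Θ : OpenPartialHomeomorph E E} {e : E} :
    e ∈ ((chartTrans I x Θ).extend I).target ↔
      e ∈ Θ.target ∧ Θ.symm e ∈ (extChartAt I x).target := by
  have h : I (I.symm e) = e := I.right_inv (I.range_eq_univ.symm ▸ mem_univ _)
  simp [chartTrans, I.range_eq_univ, h]

theorem mem_chartTrans_source {x y : M} {Θ : OpenPartialHomeomorph E E} :
    y ∈ (chartTrans I x Θ).source ↔ y ∈ (chartAt H x).source ∧ extChartAt I x y ∈ Θ.source := by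
  simp [chartTrans]

/-- These are the charts for the normal forms below: `Θ` straightens a map written in the preferred
chart. -/
theorem chartTrans_mem_maximalAtlas {n : ℕ∞ω} [IsManifold I n M] (x : M)
    {Θ : OpenPartialHomeomorph E E} (hΘ : ContDiffOn ℝ n Θ Θ.source)
    (hΘ' : ContDiffOn ℝ n Θ.symm Θ.target) :
    chartTrans I x Θ ∈ IsManifold.maximalAtlas I n M := by
  have hI : ContMDiff 𝓘(ℝ, E) I n I.symm := by
    rw [← contMDiffOn_univ, ← I.range_eq_univ]
    exact I.contMDiffOn_symm
  apply OpenPartialHomeomorph.mem_maximalAtlas_of_contMDiffOn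
  · have h₁ : ContMDiffOn I 𝓘(ℝ, E) n (extChartAt I x) (chartTrans I x Θ).source :=
      contMDiffOn_extChartAt.mono fun y hy => (mem_chartTrans_source.1 hy).1
    exact hI.comp_contMDiffOn
      (hΘ.contMDiffOn.comp h₁ fun y hy => (mem_chartTrans_source.1 hy).2)
  · have h₁ : ContMDiffOn 𝓘(ℝ, E) I n (fun e => (extChartAt I x).symm (Θ.symm e))
        ((chartTrans I x Θ).extend I).target :=
      (contMDiffOn_extChartAt_symm x).comp
        (hΘ'.contMDiffOn.mono fun e he => (mem_chartTrans_extend_target.1 he).1)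
        fun e he => (mem_chartTrans_extend_target.1 he).2
    refine h₁.comp I.contMDiff.contMDiffOn fun h hh => ?_
    rw [OpenPartialHomeomorph.extend_target, I.range_eq_univ]
    simpa using hh

end Charts

section Immersion

open Manifold

variable {E H M E' H' N F : Type*} [NormedAddCommGroup E] [NormedSpace ℝ E] [TopologicalSpace H]
  [TopologicalSpace M] [ChartedSpace H M] {I : ModelWithCorners ℝ E H} [I.Boundaryless]
  [NormedAddCommGroup E'] [NormedSpace ℝ E'] [TopologicalSpace H']
  [TopologicalSpace N] [ChartedSpace H' N] {J : ModelWithCorners ℝ E' H'} [J.Boundaryless]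
  [NormedAddCommGroup F] [NormedSpace ℝ F] [FiniteDimensional ℝ E] [FiniteDimensional ℝ E']
  [FiniteDimensional ℝ F]
  {n : ℕ∞ω} [IsManifold I n M] [IsManifold J n N] {f : M → N}

/-- An injective linear map extends to an isomorphism from a product with a complement. -/
theorem LinearMap.exists_prod_equiv_of_injective (L : E →ₗ[ℝ] E') (hL : Injective L)
    (hF : finrank ℝ E + finrank ℝ F = finrank ℝ E') :
    ∃ A : (E × F) ≃L[ℝ] E', ∀ e, A (e, 0) = L e := by
  obtain ⟨C, hC⟩ := L.range.exists_isCompl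
  have hdim : finrank ℝ F = finrank ℝ C := by
    have h₁ := Submodule.finrank_add_eq_of_isCompl hC
    rw [LinearMap.finrank_range_of_inj hL] at h₁
    omega
  let B : F ≃ₗ[ℝ] C := LinearEquiv.ofFinrankEq F C hdim
  let A : (E × F) ≃ₗ[ℝ] E' := ((LinearEquiv.ofInjective L hL).prodCongr B).trans
    (Submodule.prodEquivOfIsCompl _ _ hC)
  refine ⟨A.toContinuousLinearEquiv, fun e => ?_⟩
  simp [A]

/-- A surjective linear map is the first component of an isomorphism onto a product. -/
theorem LinearMap.exists_equiv_prod_of_surjective (L : E →ₗ[ℝ] E') (hL : Surjective L)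
    (hF : finrank ℝ E' + finrank ℝ F = finrank ℝ E) :
    ∃ A : E ≃L[ℝ] (E' × F), ∀ e, (A e).1 = L e := by
  obtain ⟨g, hg⟩ := L.exists_rightInverse_of_surjective (LinearMap.range_eq_top.2 hL)
  have hginj : Injective g := fun a b h => by
    have := congrArg L h
    simpa [← LinearMap.comp_apply, hg] using this
  obtain ⟨C, hC⟩ : ∃ C : Submodule ℝ E, IsCompl C L.ker :=
    (L.ker.exists_isCompl).imp fun _ h => h.symm
  have hdim : finrank ℝ L.ker = finrank ℝ F := by
    have h₁ := L.finrank_range_add_finrank_ker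
    rw [LinearMap.range_eq_top.2 hL, finrank_top] at h₁
    omega
  let B : L.ker ≃ₗ[ℝ] F := LinearEquiv.ofFinrankEq _ _ hdim
  let k : E →ₗ[ℝ] F := B.toLinearMap ∘ₗ (Submodule.projectionOnto L.ker C hC.symm)
  have hinj : Injective (L.prod k) := by
    rw [← LinearMap.ker_eq_bot, LinearMap.ker_eq_bot']
    intro e he
    have h₁ : L e = 0 := congrArg Prod.fst he
    have h₂ : k e = 0 := congrArg Prod.snd he
    have h₃ : Submodule.projectionOnto L.ker C hC.symm e = ⟨e, h₁⟩ :=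
      Submodule.projectionOnto_apply_left hC.symm (⟨e, h₁⟩ : L.ker)
    have h₄ : (⟨e, h₁⟩ : L.ker) = 0 := by
      rw [← h₃]
      exact B.map_eq_zero_iff.1 h₂
    exact congrArg Subtype.val h₄
  let A := LinearEquiv.ofInjectiveOfFinrankEq (L.prod k) hinj (by simp [hF])
  exact ⟨A.toContinuousLinearEquiv, fun e => rfl⟩

omit [J.Boundaryless] [FiniteDimensional ℝ E] [FiniteDimensional ℝ E'] in
theorem ContMDiff.exists_contDiffOn_writtenInExtChartAt (hf : ContMDiff I J n f) (hn : n ≠ 0)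
    (x : M) :
    ∃ U : Set E, IsOpen U ∧ extChartAt I x x ∈ U ∧
      ContDiffOn ℝ n (writtenInExtChartAt I J x f) U ∧
      HasFDerivAt (writtenInExtChartAt I J x f) (mfderiv I J f x : E →L[ℝ] E')
        (extChartAt I x x) := by
  refine ⟨(extChartAt I x).target ∩
    (extChartAt I x).symm ⁻¹' (f ⁻¹' (extChartAt J (f x)).source), ?_, ?_, ?_, ?_⟩
  · exact (continuousOn_extChartAt_symm x).isOpen_inter_preimage (isOpen_extChartAt_target x)
      ((isOpen_extChartAt_source (f x)).preimage hf.continuous)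
  · exact ⟨mem_extChartAt_target x, by simp⟩
  · exact (contMDiff_iff.1 hf).2 x (f x)
  · have h := (hf.mdifferentiable hn x).hasMFDerivAt.2
    rw [I.range_eq_univ] at h
    exact hasFDerivWithinAt_univ.1 h

/-- A smooth map between finite-dimensional manifolds whose differential at a point is injective
is an immersion at that point. -/
theorem Manifold.isImmersionAtOfComplement_of_injective_mfderiv
    (hn : n ≠ 0) (hf : ContMDiff I J n f) {x : M}
    (hx : Injective (mfderiv I J f x)) (hF : finrank ℝ E + finrank ℝ F = finrank ℝ E') :
    IsImmersionAtOfComplement F I J n f x := by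
  obtain ⟨U, hU, hxU, hg, hg'⟩ := hf.exists_contDiffOn_writtenInExtChartAt hn x
  set g := writtenInExtChartAt I J x f
  let D : E →L[ℝ] E' := mfderiv I J f x
  replace hg' : HasFDerivAt g D (extChartAt I x x) := hg'
  obtain ⟨A, hA⟩ := D.toLinearMap.exists_prod_equiv_of_injective (F := F) hx hF
  -- Thickening `g` by a complement of the image of its differential gives a map between spaces of
  -- equal dimension, with derivative `A` at the base point.
  let Φ : E × F → E' := fun p => g p.1 + A (0, p.2)
  have hΦ : ContDiffOn ℝ n Φ (U ×ˢ univ) :=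
    (hg.comp contDiff_fst.contDiffOn fun p hp => hp.1).add
      (A.contDiff.comp (contDiff_const.prodMk contDiff_snd)).contDiffOn
  have hΦ' : HasFDerivAt Φ (A : E × F →L[ℝ] E') (extChartAt I x x, 0) := by
    have h₁ : HasFDerivAt (fun p : E × F => g p.1)
        (D.comp (ContinuousLinearMap.fst ℝ E F))
        (extChartAt I x x, 0) :=
      HasFDerivAt.comp (g := g) (f := Prod.fst) (extChartAt I x x, (0 : F)) hg' hasFDerivAt_fst
    have h₂ : HasFDerivAt (fun p : E × F => A (0, p.2))
        ((A : E × F →L[ℝ] E').comp ((ContinuousLinearMap.inr ℝ E F).comp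
          (ContinuousLinearMap.snd ℝ E F))) (extChartAt I x x, 0) :=
      ((A : E × F →L[ℝ] E').comp ((ContinuousLinearMap.inr ℝ E F).comp
          (ContinuousLinearMap.snd ℝ E F))).hasFDerivAt
    have hAD : (A : E × F →L[ℝ] E') = D.comp (ContinuousLinearMap.fst ℝ E F) +
        (A : E × F →L[ℝ] E').comp ((ContinuousLinearMap.inr ℝ E F).comp
          (ContinuousLinearMap.snd ℝ E F)) := by
      refine ContinuousLinearMap.ext fun p => ?_
      have : p = (p.1, 0) + (0, p.2) := by simp
      calc A p = A (p.1, 0) + A (0, p.2) := by rw [← map_add, ← this]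
        _ = _ := by rw [hA]; rfl
    rw [hAD]
    exact h₁.add h₂
  obtain ⟨Θ, hΘx, hΘ, hΘc, hΘc'⟩ :=
    hΦ.exists_openPartialHomeomorph hn (hU.prod isOpen_univ) ⟨hxU, mem_univ _⟩ hΦ'
  -- Since `g e = Θ (e, 0)`, following the codomain chart by `A ∘ Θ.symm` turns `f` into `e ↦ A (e,
  -- 0)`.
  let Ξ : OpenPartialHomeomorph E' E' := Θ.symm.transHomeomorph A.toHomeomorph
  have hΞ : ContDiffOn ℝ n Ξ Ξ.source := A.contDiff.comp_contDiffOn hΘc'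
  have hΞ' : ContDiffOn ℝ n Ξ.symm Ξ.target :=
    hΘc.comp A.symm.contDiff.contDiffOn fun y hy => hy
  let V : Set M := (extChartAt I x).source ∩
    extChartAt I x ⁻¹' ((fun e => (e, (0 : F))) ⁻¹' Θ.source)
  have hV : IsOpen V := (continuousOn_extChartAt x).isOpen_inter_preimage
    (isOpen_extChartAt_source x) (Θ.open_source.preimage (by fun_prop))
  have hgx : g (extChartAt I x x) = extChartAt J (f x) (f x) := by
    simp [g, writtenInExtChartAt]
  have hΘx' : extChartAt J (f x) (f x) ∈ Θ.target := by
    have h := Θ.map_source hΘx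
    have h₀ : Φ (extChartAt I x x, 0) = extChartAt J (f x) (f x) := by
      change g (extChartAt I x x) + A ((0 : E), (0 : F)) = _
      rw [hgx, Prod.mk_zero_zero, map_zero, add_zero]
    rwa [hΘ, h₀] at h
  refine IsImmersionAtOfComplement.mk_of_continuousAt hf.continuous.continuousAt A
    ((chartAt H x).restr V) (chartTrans J (f x) Ξ) ?_ ?_ ?_
    (chartTrans_mem_maximalAtlas _ hΞ hΞ') ?_
  · simp only [OpenPartialHomeomorph.restr_source, hV.interior_eq]
    exact ⟨mem_chart_source H x, mem_extChartAt_source x, hΘx⟩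
  · exact mem_chartTrans_source.2 ⟨mem_chart_source H' (f x), hΘx'⟩
  · exact restr_mem_maximalAtlas (contDiffGroupoid n I) (IsManifold.chart_mem_maximalAtlas x) hV
  · intro e he
    have he' : (extChartAt I x).symm e ∈ V ∧ e ∈ (extChartAt I x).target := by
      rw [OpenPartialHomeomorph.extend_target, I.range_eq_univ] at he
      simpa [hV.interior_eq, extChartAt_target, I.range_eq_univ, and_comm] using he
    have h₁ : (e, (0 : F)) ∈ Θ.source := by
      have h : (extChartAt I x ((extChartAt I x).symm e), (0 : F)) ∈ Θ.source := he'.1.2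
      rwa [(extChartAt I x).right_inv he'.2] at h
    have h₂ : extChartAt J (f x) (f ((extChartAt I x).symm e)) = Θ (e, 0) := by
      simp [hΘ, Φ, g, writtenInExtChartAt]
    change (chartTrans J (f x) Ξ).extend J (f ((extChartAt I x).symm e)) = A (e, 0)
    rw [chartTrans_extend_apply, h₂]
    change A (Θ.symm (Θ (e, 0))) = _
    rw [Θ.left_inv h₁]

omit [J.Boundaryless] in
/-- A smooth map between finite-dimensional manifolds whose differential at a point is surjective
is a submersion at that point. -/
theorem Manifold.isSubmersionAtOfComplement_of_surjective_mfderiv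
    (hn : n ≠ 0) (hf : ContMDiff I J n f) {x : M}
    (hx : Surjective (mfderiv I J f x)) (hF : finrank ℝ E' + finrank ℝ F = finrank ℝ E) :
    IsSubmersionAtOfComplement F I J n f x := by
  obtain ⟨U, hU, hxU, hg, hg'⟩ := hf.exists_contDiffOn_writtenInExtChartAt hn x
  set g := writtenInExtChartAt I J x f
  let D : E →L[ℝ] E' := mfderiv I J f x
  replace hg' : HasFDerivAt g D (extChartAt I x x) := hg'
  obtain ⟨A, hA⟩ := D.toLinearMap.exists_equiv_prod_of_surjective (F := F) hx hF
  -- Completing `g` by the kernel coordinates of `A` makes the derivative at the base point equal to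
  -- `A`.
  let Φ : E → E' × F := fun e => (g e, (A e).2)
  have hΦ : ContDiffOn ℝ n Φ U :=
    hg.prodMk (contDiff_snd.comp A.contDiff).contDiffOn
  have hΦ' : HasFDerivAt Φ (A : E →L[ℝ] E' × F) (extChartAt I x x) := by
    have h₂ := ((ContinuousLinearMap.snd ℝ E' F).comp (A : E →L[ℝ] E' × F)).hasFDerivAt
      (x := extChartAt I x x)
    have hAD : (A : E →L[ℝ] E' × F) =
        D.prod ((ContinuousLinearMap.snd ℝ E' F).comp (A : E →L[ℝ] E' × F)) :=
      ContinuousLinearMap.ext fun e => Prod.ext (hA e) rfl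
    rw [hAD]
    exact hg'.prodMk h₂
  obtain ⟨Θ, hΘx, hΘ, hΘc, hΘc'⟩ := hΦ.exists_openPartialHomeomorph hn hU hxU hΦ'
  let Ξ : OpenPartialHomeomorph E E := Θ.transHomeomorph A.symm.toHomeomorph
  have hΞ : ContDiffOn ℝ n Ξ Ξ.source := A.symm.contDiff.comp_contDiffOn hΘc
  have hΞ' : ContDiffOn ℝ n Ξ.symm Ξ.target :=
    hΘc'.comp A.contDiff.contDiffOn fun y hy => hy
  refine IsSubmersionAtOfComplement.mk_of_continuousAt hf.continuous.continuousAt A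
    (chartTrans I x Ξ) (chartAt H' (f x)) ?_ (mem_chart_source _ _)
    (chartTrans_mem_maximalAtlas _ hΞ hΞ') (IsManifold.chart_mem_maximalAtlas _) ?_
  · exact mem_chartTrans_source.2 ⟨mem_chart_source H x, hΘx⟩
  · intro e he
    obtain ⟨he₁, he₂⟩ := mem_chartTrans_extend_target.1 he
    have he₃ : A e ∈ Θ.target := he₁
    change extChartAt J (f x) (f (((chartTrans I x Ξ).extend I).symm e)) = (A e).1
    rw [chartTrans_extend_symm_apply]
    change g (Θ.symm (A e)) = (A e).1
    have := congrArg Prod.fst (Θ.right_inv he₃)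
    rwa [hΘ] at this

end Immersion

/-! ### Local sections of submersions and descent of smoothness. -/

section Submersion

open Manifold

variable {E H M E' H' N E'' H'' P : Type*} [NormedAddCommGroup E] [NormedSpace ℝ E]
  [TopologicalSpace H] [TopologicalSpace M] [ChartedSpace H M] {I : ModelWithCorners ℝ E H}
  [I.Boundaryless]
  [NormedAddCommGroup E'] [NormedSpace ℝ E'] [TopologicalSpace H']
  [TopologicalSpace N] [ChartedSpace H' N] {J : ModelWithCorners ℝ E' H'}
  [NormedAddCommGroup E''] [NormedSpace ℝ E''] [TopologicalSpace H'']
  [TopologicalSpace P] [ChartedSpace H'' P] {J' : ModelWithCorners ℝ E'' H''}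
  {n : ℕ∞ω}

/-- A submersion has a local smooth section through every point. -/
theorem Manifold.IsSubmersion.exists_section {q : M → N} (hq : IsSubmersion I J n q) (x : M) :
    ∃ σ : N → M, ContMDiffAt J I n σ (q x) ∧ σ (q x) = x ∧ ∀ᶠ y in 𝓝 (q x), q (σ y) = y := by
  have h := hq.isSubmersionAt x
  set φ := h.domChart.extend I with hφ
  set ψ := h.codChart.extend J with hψ
  have hxφ : x ∈ φ.source := by
    rw [hφ, OpenPartialHomeomorph.extend_source]; exact h.mem_domChart_source
  have hxψ : q x ∈ ψ.source := by
    rw [hψ, OpenPartialHomeomorph.extend_source]; exact h.mem_codChart_source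
  have hφo : IsOpen φ.target := h.domChart.isOpen_extend_target
  have hwr : ∀ e ∈ φ.target, ψ (q (φ.symm e)) = (h.equiv e).1 := h.writtenInCharts
  have hx1 : (h.equiv (φ x)).1 = ψ (q x) := by
    rw [← hwr _ (φ.map_source hxφ), φ.left_inv hxφ]
  -- In the normal form `q` is a projection; the section freezes the other coordinate at its value
  -- at `x`.
  let j : N → E := fun y => h.equiv.symm (ψ y, (h.equiv (φ x)).2)
  have hjx : j (q x) = φ x := by
    have : (ψ (q x), (h.equiv (φ x)).2) = h.equiv (φ x) := Prod.ext hx1.symm rfl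
    simp only [j, this, ContinuousLinearEquiv.symm_apply_apply]
  have hψs : ContMDiffAt J 𝓘(ℝ, E') n ψ (q x) :=
    J.contMDiff.contMDiffAt.comp _
      (contMDiffAt_of_mem_maximalAtlas h.codChart_mem_maximalAtlas h.mem_codChart_source)
  have hj : ContMDiffAt J 𝓘(ℝ, E) n j (q x) := by
    have h₁ : ContDiff ℝ n fun w : E' => h.equiv.symm (w, (h.equiv (φ x)).2) :=
      h.equiv.symm.contDiff.comp (contDiff_id.prodMk contDiff_const)
    exact h₁.contMDiff.contMDiffAt.comp _ hψs
  have hφs : ContMDiffAt 𝓘(ℝ, E) I n φ.symm (j (q x)) := by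
    rw [hjx]
    refine (contMDiffOn_extend_symm h.domChart_mem_maximalAtlas).contMDiffAt
      (Filter.mem_of_superset (hφo.mem_nhds (φ.map_source hxφ)) ?_)
    rw [hφ, OpenPartialHomeomorph.extend_target_eq_image_source]
    rintro _ ⟨y, hy, rfl⟩
    exact ⟨h.domChart y, h.domChart.map_source hy, rfl⟩
  have hjt : ∀ᶠ y in 𝓝 (q x), j y ∈ φ.target :=
    hj.continuousAt (hφo.mem_nhds (by rw [hjx]; exact φ.map_source hxφ))
  refine ⟨φ.symm ∘ j, hφs.comp _ hj, ?_, ?_⟩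
  · rw [comp_apply, hjx, φ.left_inv hxφ]
  · have hso : ∀ᶠ y in 𝓝 (q x), y ∈ ψ.source :=
      (h.codChart.isOpen_extend_source).mem_nhds hxψ
    filter_upwards [hjt, hso] with y hy hys
    refine ψ.injOn ?_ hys ?_
    · rw [hψ, OpenPartialHomeomorph.extend_source]
      refine h.source_subset_preimage_source ?_
      rw [← OpenPartialHomeomorph.extend_source (I := I)]
      exact φ.map_target hy
    · rw [comp_apply, hwr _ hy]
      simp [j]

/-- A map out of the target of a surjective submersion is smooth if its composition with the
submersion is. -/
theorem Manifold.IsSubmersion.contMDiff_of_comp {q : M → N} (hq : IsSubmersion I J n q)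
    (hs : Surjective q) {f : N → P} (hf : ContMDiff I J' n (f ∘ q)) : ContMDiff J J' n f := by
  intro y
  obtain ⟨x, rfl⟩ := hs y
  obtain ⟨σ, hσ, hσx, hσq⟩ := hq.exists_section x
  have h : ContMDiffAt J J' n ((f ∘ q) ∘ σ) (q x) := (hf _).comp _ hσ
  refine h.congr_of_eventuallyEq ?_
  filter_upwards [hσq] with y hy
  simp [hy]

end Submersion

/-! ### Smooth structures transported along homeomorphisms. -/

section Transport

variable {E H M M' : Type*} [NormedAddCommGroup E] [NormedSpace ℝ E]
  [TopologicalSpace H] [TopologicalSpace M] [ChartedSpace H M] (I : ModelWithCorners ℝ E H)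
  (n : ℕ∞ω) [IsManifold I n M] [TopologicalSpace M']

/-- A smooth structure can be transported along a homeomorphism. -/
theorem Homeomorph.exists_chartedSpace_contMDiff (e : M' ≃ₜ M) :
    ∃ _ : ChartedSpace H M', IsManifold I n M' ∧ ContMDiff I I n e ∧ ContMDiff I I n e.symm := by
  let c : ChartedSpace H M' :=
    { atlas := (fun φ : OpenPartialHomeomorph M H => e.transOpenPartialHomeomorph φ) '' atlas H M
      chartAt := fun x => e.transOpenPartialHomeomorph (chartAt H (e x))
      mem_chart_source := fun x => by simp
      chart_mem_atlas := fun x => ⟨_, chart_mem_atlas H (e x), rfl⟩ }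
  have hm : IsManifold I n M' := by
    refine { compatible := ?_ }
    rintro _ _ ⟨φ, hφ, rfl⟩ ⟨ψ, hψ, rfl⟩
    -- The homeomorphism cancels, so the transition maps are those of `M`.
    have h : (e.transOpenPartialHomeomorph φ).symm.trans (e.transOpenPartialHomeomorph ψ) =
        φ.symm.trans ψ := by
      ext x
      · simp
      · simp
      · simp
    rw [h]
    exact (contDiffGroupoid n I).compatible hφ hψ
  refine ⟨c, hm, fun x => ?_, fun y => ?_⟩
  · have h₁ : ContMDiffAt I I n (chartAt H x) x :=
      contMDiffOn_chart.contMDiffAt (chart_source_mem_nhds H x)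
    have h₂ : ContMDiffAt I I n (chartAt H (e x)).symm (chartAt H x x) :=
      (contMDiffOn_chart_symm (x := e x)).contMDiffAt
        ((chartAt H (e x)).open_target.mem_nhds (mem_chart_target H (e x)))
    refine (h₂.comp x h₁).congr_of_eventuallyEq ?_
    filter_upwards [(chartAt H x).open_source.mem_nhds (mem_chart_source H x)] with y hy
    exact ((chartAt H (e x)).left_inv hy).symm
  · obtain ⟨x, rfl⟩ := e.surjective y
    have h₁ : ContMDiffAt I I n (chartAt H (e x)) (e x) :=
      contMDiffOn_chart.contMDiffAt (chart_source_mem_nhds H (e x))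
    have h₂ : ContMDiffAt I I n (chartAt H x).symm (chartAt H (e x) (e x)) :=
      (contMDiffOn_chart_symm (x := x)).contMDiffAt
        ((chartAt H x).open_target.mem_nhds (mem_chart_target H x))
    refine (h₂.comp (e x) h₁).congr_of_eventuallyEq ?_
    filter_upwards [(chartAt H (e x)).open_source.mem_nhds (mem_chart_source H (e x))] with y hy
    exact congrArg e.symm ((chartAt H (e x)).left_inv hy).symm

end Transport

/-! ### The level set as a three-sphere, and the Hopf map. -/

namespace SphereCut

/-- Euclidean four-space. -/
abbrev E4 : Type := EuclideanSpace ℝ (Fin 4)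

/-- The unit sphere in four-space. -/
abbrev S3 : Type := Metric.sphere (0 : E4) 1

instance factFinrankE4 : Fact (finrank ℝ E4 = 3 + 1) := ⟨by simp⟩

theorem mem_sphere_E3 {v : E3} :
    v ∈ Metric.sphere (0 : E3) 1 ↔ v 0 ^ 2 + v 1 ^ 2 + v 2 ^ 2 = 1 := by
  rw [mem_sphere_zero_iff_norm, ← sq_eq_sq₀ (norm_nonneg _) zero_le_one, one_pow,
    EuclideanSpace.norm_sq_eq, Fin.sum_univ_three]
  simp only [Real.norm_eq_abs, sq_abs]

theorem mem_sphere_E4 {v : E4} :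
    v ∈ Metric.sphere (0 : E4) 1 ↔ v 0 ^ 2 + v 1 ^ 2 + v 2 ^ 2 + v 3 ^ 2 = 1 := by
  rw [mem_sphere_zero_iff_norm, ← sq_eq_sq₀ (norm_nonneg _) zero_le_one, one_pow,
    EuclideanSpace.norm_sq_eq, Fin.sum_univ_four]
  simp only [Real.norm_eq_abs, sq_abs]

/-- Data describing a cut of the sphere: `s = ± 1` is the pole that stays in the interior, `R` the
height of the remaining cap, `K` the maximal value of `|u| ^ 2` on the level set, and `ε` the sign
of the cut. -/
structure Cap where
  s : ℝ
  R : ℝ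
  K : ℝ
  ε : ℤˣ
  s_sq : s ^ 2 = 1
  R_pos : 0 < R
  R_lt : R < 2
  K_pos : 0 < K

namespace Cap

variable (c : Cap)

/-- The sign of the cut as a real number. -/
def sgn : ℝ := ((c.ε : ℤ) : ℝ)

theorem sgn_sq : c.sgn ^ 2 = 1 := by
  rcases Int.units_eq_one_or c.ε with h | h <;> simp [sgn, h]

/-- The radius function of the parametrization of the cap. -/
def rad (y : E4) : ℝ := √(c.R * (2 - c.R * (y 0 ^ 2 + y 1 ^ 2)))

/-- The Darboux parametrization of the cap by the first two coordinates of a point. -/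
def capAmb (y : E4) : E3 :=
  !₂[y 0 * c.rad y, y 1 * c.rad y, c.s * (1 - c.R * (y 0 ^ 2 + y 1 ^ 2))]

/-- The complex component of the parametrization of the level set. -/
def capC (y : E4) : ℂ := ⟨√c.K * y 2, √c.K * (c.sgn * y 3)⟩

/-- The inverse of the parametrization of the level set. -/
def coord (m : E3) (u : ℂ) : E4 :=
  !₂[m 0 / √(c.R * (1 + c.s * m 2)), m 1 / √(c.R * (1 + c.s * m 2)), u.re / √c.K,
    c.sgn * u.im / √c.K]

/-- The Hopf map. -/
def hopfAmb (y : E4) : E3 :=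
  !₂[2 * (y 0 * y 2 - y 1 * y 3), 2 * (y 0 * y 3 + y 1 * y 2),
    c.s * (y 2 ^ 2 + y 3 ^ 2 - y 0 ^ 2 - y 1 ^ 2)]

@[simp] theorem capAmb_zero (y : E4) : c.capAmb y 0 = y 0 * c.rad y := rfl
@[simp] theorem capAmb_one (y : E4) : c.capAmb y 1 = y 1 * c.rad y := rfl
@[simp] theorem capAmb_two (y : E4) :
    c.capAmb y 2 = c.s * (1 - c.R * (y 0 ^ 2 + y 1 ^ 2)) := rfl
@[simp] theorem hopfAmb_zero (y : E4) : c.hopfAmb y 0 = 2 * (y 0 * y 2 - y 1 * y 3) := rfl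
@[simp] theorem hopfAmb_one (y : E4) : c.hopfAmb y 1 = 2 * (y 0 * y 3 + y 1 * y 2) := rfl
@[simp] theorem hopfAmb_two (y : E4) :
    c.hopfAmb y 2 = c.s * (y 2 ^ 2 + y 3 ^ 2 - y 0 ^ 2 - y 1 ^ 2) := rfl
@[simp] theorem coord_zero (m : E3) (u : ℂ) :
    c.coord m u 0 = m 0 / √(c.R * (1 + c.s * m 2)) := rfl
@[simp] theorem coord_one (m : E3) (u : ℂ) :
    c.coord m u 1 = m 1 / √(c.R * (1 + c.s * m 2)) := rfl
@[simp] theorem coord_two (m : E3) (u : ℂ) : c.coord m u 2 = u.re / √c.K := rfl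
@[simp] theorem coord_three (m : E3) (u : ℂ) : c.coord m u 3 = c.sgn * u.im / √c.K := rfl

/-- The equation of the level set in `S² × ℂ`. -/
def IsLevel (m : E3) (u : ℂ) : Prop := ‖u‖ ^ 2 = c.K / c.R * (c.R - 1 + c.s * m 2)

variable {c}

theorem norm_sq_eq (u : ℂ) : ‖u‖ ^ 2 = u.re ^ 2 + u.im ^ 2 := by
  rw [← Complex.normSq_eq_norm_sq, Complex.normSq_apply]; ring

/-- Since |u|² ≥ 0 gives s z ≥ 1 − R and R < 2, the pole −s is off the level set. This keeps the
square root in `coord` positive and smooth. -/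
theorem IsLevel.pos {m : E3} {u : ℂ} (h : c.IsLevel m u) : 0 < 1 + c.s * m 2 := by
  have h₁ : 0 ≤ c.K / c.R * (c.R - 1 + c.s * m 2) := h ▸ sq_nonneg _
  have h₂ : 0 ≤ c.R - 1 + c.s * m 2 := nonneg_of_mul_nonneg_right h₁ (div_pos c.K_pos c.R_pos)
  linarith [c.R_lt]

theorem rad_arg_pos (y : S3) : 0 < c.R * (2 - c.R * ((y : E4) 0 ^ 2 + (y : E4) 1 ^ 2)) := by
  have hy := mem_sphere_E4.1 y.2
  refine mul_pos c.R_pos ?_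
  nlinarith [c.R_pos, c.R_lt, sq_nonneg ((y : E4) 2), sq_nonneg ((y : E4) 3)]

theorem rad_sq (y : S3) :
    c.rad y ^ 2 = c.R * (2 - c.R * ((y : E4) 0 ^ 2 + (y : E4) 1 ^ 2)) :=
  Real.sq_sqrt (rad_arg_pos y).le

theorem rad_pos (y : S3) : 0 < c.rad y := Real.sqrt_pos.2 (rad_arg_pos y)

/-- With ρ² = y₀² + y₁², the radius is forced by ρ² rad² + (1 − Rρ²)² = 1, that is, rad² = R(2 −
Rρ²). -/
theorem capAmb_mem (y : S3) : c.capAmb y ∈ Metric.sphere (0 : E3) 1 := by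
  rw [mem_sphere_E3]
  have h := c.rad_sq y
  simp only [capAmb_zero, capAmb_one, capAmb_two]
  linear_combination ((y : E4) 0 ^ 2 + (y : E4) 1 ^ 2) * h +
    (1 - c.R * ((y : E4) 0 ^ 2 + (y : E4) 1 ^ 2)) ^ 2 * c.s_sq

theorem hopfAmb_mem (y : S3) : c.hopfAmb y ∈ Metric.sphere (0 : E3) 1 := by
  rw [mem_sphere_E3]
  have h := mem_sphere_E4.1 y.2
  simp only [hopfAmb_zero, hopfAmb_one, hopfAmb_two]
  linear_combination ((y : E4) 0 ^ 2 + (y : E4) 1 ^ 2 + (y : E4) 2 ^ 2 + (y : E4) 3 ^ 2 + 1) * h +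
    ((y : E4) 2 ^ 2 + (y : E4) 3 ^ 2 - (y : E4) 0 ^ 2 - (y : E4) 1 ^ 2) ^ 2 * c.s_sq

theorem isLevel_cap (y : S3) : c.IsLevel (c.capAmb y) (c.capC y) := by
  have h := mem_sphere_E4.1 y.2
  have hK := Real.sq_sqrt c.K_pos.le
  have hR := c.R_pos.ne'
  simp only [IsLevel, norm_sq_eq, capC, capAmb_two]
  field_simp
  linear_combination c.R * ((y : E4) 2 ^ 2 + (y : E4) 3 ^ 2 * c.sgn ^ 2) * hK +
    c.R * c.K * (y : E4) 3 ^ 2 * c.sgn_sq + c.K * c.R * h -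
    c.K * (1 - c.R * ((y : E4) 0 ^ 2 + (y : E4) 1 ^ 2)) * c.s_sq

theorem coord_mem {m : E3} (hm : m ∈ Metric.sphere (0 : E3) 1) {u : ℂ} (h : c.IsLevel m u) :
    c.coord m u ∈ Metric.sphere (0 : E4) 1 := by
  rw [mem_sphere_E3] at hm
  rw [mem_sphere_E4]
  have hK := c.K_pos.ne'
  have hR := c.R_pos.ne'
  have hp := h.pos.ne'
  have hs := Real.sq_sqrt (mul_pos c.R_pos h.pos).le
  rw [IsLevel, norm_sq_eq] at h
  simp only [coord_zero, coord_one, coord_two, coord_three, div_pow, mul_pow, hs,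
    Real.sq_sqrt c.K_pos.le, c.sgn_sq]
  have h₁ : (m 0 ^ 2 + m 1 ^ 2) / (c.R * (1 + c.s * m 2)) = (1 - c.s * m 2) / c.R := by
    field_simp
    linear_combination hm + m 2 ^ 2 * c.s_sq
  have h₂ : (u.re ^ 2 + u.im ^ 2) / c.K = (c.R - 1 + c.s * m 2) / c.R := by
    rw [h]
    field_simp
  calc _ = (m 0 ^ 2 + m 1 ^ 2) / (c.R * (1 + c.s * m 2)) + (u.re ^ 2 + u.im ^ 2) / c.K := by ring
    _ = 1 := by
      rw [h₁, h₂]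
      field_simp
      ring

theorem coord_cap (y : S3) : c.coord (c.capAmb y) (c.capC y) = y := by
  have h : c.R * (1 + c.s * c.capAmb y 2) =
      c.R * (2 - c.R * ((y : E4) 0 ^ 2 + (y : E4) 1 ^ 2)) := by
    rw [capAmb_two]
    linear_combination c.R * (1 - c.R * ((y : E4) 0 ^ 2 + (y : E4) 1 ^ 2)) * c.s_sq
  have hr : √(c.R * (1 + c.s * c.capAmb y 2)) = c.rad y := by rw [h]; rfl
  have hr₀ := (c.rad_pos y).ne'
  have hK := (Real.sqrt_pos.2 c.K_pos).ne'
  ext i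
  fin_cases i
  · change c.coord _ _ 0 = (y : E4) 0
    rw [coord_zero, hr, capAmb_zero, mul_div_cancel_right₀ _ hr₀]
  · change c.coord _ _ 1 = (y : E4) 1
    rw [coord_one, hr, capAmb_one, mul_div_cancel_right₀ _ hr₀]
  · change √c.K * (y : E4) 2 / √c.K = (y : E4) 2
    field_simp
  · change c.sgn * (√c.K * (c.sgn * (y : E4) 3)) / √c.K = (y : E4) 3
    field_simp
    linear_combination (y : E4) 3 * c.sgn_sq

theorem rad_coord {m : E3} (hm : m ∈ Metric.sphere (0 : E3) 1) {u : ℂ} (h : c.IsLevel m u) :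
    c.R * (c.coord m u 0 ^ 2 + c.coord m u 1 ^ 2) = 1 - c.s * m 2 := by
  rw [mem_sphere_E3] at hm
  have hR := c.R_pos.ne'
  have hp := h.pos.ne'
  simp only [coord_zero, coord_one, div_pow, Real.sq_sqrt (mul_pos c.R_pos h.pos).le]
  field_simp
  linear_combination hm + m 2 ^ 2 * c.s_sq

theorem capAmb_coord {m : E3} (hm : m ∈ Metric.sphere (0 : E3) 1) {u : ℂ} (h : c.IsLevel m u) :
    c.capAmb (c.coord m u) = m := by
  have h₁ := rad_coord hm h
  have h₂ : c.rad (c.coord m u) = √(c.R * (1 + c.s * m 2)) := by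
    rw [rad, h₁]; congr 2; ring
  have h₃ := (Real.sqrt_pos.2 (mul_pos c.R_pos h.pos)).ne'
  ext i
  fin_cases i
  · change c.capAmb _ 0 = m 0
    rw [capAmb_zero, h₂, coord_zero, div_mul_cancel₀ _ h₃]
  · change c.capAmb _ 1 = m 1
    rw [capAmb_one, h₂, coord_one, div_mul_cancel₀ _ h₃]
  · change c.capAmb _ 2 = m 2
    rw [capAmb_two, h₁]
    linear_combination m 2 * c.s_sq

theorem capC_coord (m : E3) (u : ℂ) : c.capC (c.coord m u) = u := by
  have hK := (Real.sqrt_pos.2 c.K_pos).ne'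
  apply Complex.ext
  · change √c.K * (u.re / √c.K) = u.re
    field_simp
  · change √c.K * (c.sgn * (c.sgn * u.im / √c.K)) = u.im
    field_simp
    linear_combination u.im * c.sgn_sq

variable (c)

/-- The parametrization of the level set by the three-sphere. -/
def cap (y : S3) : S2 × ℂ := (⟨c.capAmb y, capAmb_mem y⟩, c.capC y)

/-- The Hopf map to the two-sphere. -/
def hopf (y : S3) : S2 := ⟨c.hopfAmb y, hopfAmb_mem y⟩

/-! #### The Hopf fibration and the circle action -/

/-- The action on the three-sphere that corresponds to the action on the level set. -/
def turn (a : Circle) (y : E4) : E4 :=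
  !₂[(a : ℂ).re * y 0 - (a : ℂ).im * y 1, (a : ℂ).im * y 0 + (a : ℂ).re * y 1,
    (a : ℂ).re * y 2 + (a : ℂ).im * y 3, -(a : ℂ).im * y 2 + (a : ℂ).re * y 3]

theorem circle_sq (a : Circle) : (a : ℂ).re ^ 2 + (a : ℂ).im ^ 2 = 1 := by
  have := Circle.normSq_coe a
  rw [Complex.normSq_apply] at this
  linarith

@[simp] theorem turn_zero (a : Circle) (y : E4) :
    turn a y 0 = (a : ℂ).re * y 0 - (a : ℂ).im * y 1 := rfl
@[simp] theorem turn_one (a : Circle) (y : E4) :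
    turn a y 1 = (a : ℂ).im * y 0 + (a : ℂ).re * y 1 := rfl
@[simp] theorem turn_two (a : Circle) (y : E4) :
    turn a y 2 = (a : ℂ).re * y 2 + (a : ℂ).im * y 3 := rfl
@[simp] theorem turn_three (a : Circle) (y : E4) :
    turn a y 3 = -(a : ℂ).im * y 2 + (a : ℂ).re * y 3 := rfl

theorem hopfAmb_turn (a : Circle) (y : E4) : c.hopfAmb (turn a y) = c.hopfAmb y := by
  have ha := circle_sq a
  ext i
  fin_cases i
  · change c.hopfAmb _ 0 = c.hopfAmb _ 0
    simp only [hopfAmb_zero, turn_zero, turn_one, turn_two, turn_three]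
    linear_combination (2 * (y 0 * y 2 - y 1 * y 3)) * ha
  · change c.hopfAmb _ 1 = c.hopfAmb _ 1
    simp only [hopfAmb_one, turn_zero, turn_one, turn_two, turn_three]
    linear_combination (2 * (y 0 * y 3 + y 1 * y 2)) * ha
  · change c.hopfAmb _ 2 = c.hopfAmb _ 2
    simp only [hopfAmb_two, turn_zero, turn_one, turn_two, turn_three]
    linear_combination (c.s * (y 2 ^ 2 + y 3 ^ 2 - y 0 ^ 2 - y 1 ^ 2)) * ha

theorem exists_circle {p q : ℝ} (h : p ^ 2 + q ^ 2 = 1) :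
    ∃ a : Circle, (a : ℂ).re = p ∧ (a : ℂ).im = q := by
  refine ⟨⟨⟨p, q⟩, mem_sphere_zero_iff_norm.2 ?_⟩, rfl, rfl⟩
  rw [← sq_eq_sq₀ (norm_nonneg _) zero_le_one, norm_sq_eq, h, one_pow]

/-- The Hopf image and the sphere equation determine |w|, |v| and wv. If w ≠ 0, take a = w'/w; then
wv = w'v' forces v' = a⁻¹v. If w = 0, then |v| = |v'| = 1 and a is v times the conjugate of v'. -/
theorem exists_turn {y y' : S3} (h : c.hopf y = c.hopf y') :
    ∃ a : Circle, (y' : E4) = turn a y := by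
  obtain ⟨y, hy⟩ := y
  obtain ⟨y', hy'⟩ := y'
  rw [mem_sphere_E4] at hy hy'
  have hs : c.s ≠ 0 := fun h => by have := c.s_sq; simp [h] at this
  have h₀ : c.hopfAmb y 0 = c.hopfAmb y' 0 := congrArg (fun v : S2 => (v : E3) 0) h
  have h₁ : c.hopfAmb y 1 = c.hopfAmb y' 1 := congrArg (fun v : S2 => (v : E3) 1) h
  have h₂ : c.hopfAmb y 2 = c.hopfAmb y' 2 := congrArg (fun v : S2 => (v : E3) 2) h
  simp only [hopfAmb_zero, hopfAmb_one, hopfAmb_two] at h₀ h₁ h₂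
  replace h₂ := mul_left_cancel₀ hs h₂
  have hw : y' 0 ^ 2 + y' 1 ^ 2 = y 0 ^ 2 + y 1 ^ 2 := by linarith
  have hu : y' 2 ^ 2 + y' 3 ^ 2 = y 2 ^ 2 + y 3 ^ 2 := by linarith
  by_cases hr : y 0 ^ 2 + y 1 ^ 2 = 0
  · have hz : y 0 = 0 ∧ y 1 = 0 := by constructor <;> nlinarith [sq_nonneg (y 0), sq_nonneg (y 1)]
    have hz' : y' 0 = 0 ∧ y' 1 = 0 := by
      constructor <;> nlinarith [sq_nonneg (y' 0), sq_nonneg (y' 1)]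
    have hu₁ : y 2 ^ 2 + y 3 ^ 2 = 1 := by linarith
    obtain ⟨a, ha, ha'⟩ := exists_circle (p := y 2 * y' 2 + y 3 * y' 3)
      (q := y 3 * y' 2 - y 2 * y' 3)
      (by linear_combination (y' 2 ^ 2 + y' 3 ^ 2) * hu₁ + hu + hu₁)
    refine ⟨a, ?_⟩
    ext i
    fin_cases i
    · change y' 0 = turn a y 0
      simp [hz, hz']
    · change y' 1 = turn a y 1
      simp [hz, hz']
    · change y' 2 = turn a y 2
      rw [turn_two, ha, ha']
      linear_combination -y' 2 * hu₁
    · change y' 3 = turn a y 3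
      rw [turn_three, ha, ha']
      linear_combination -y' 3 * hu₁
  · obtain ⟨a, ha, ha'⟩ := exists_circle
      (p := (y' 0 * y 0 + y' 1 * y 1) / (y 0 ^ 2 + y 1 ^ 2))
      (q := (y' 1 * y 0 - y' 0 * y 1) / (y 0 ^ 2 + y 1 ^ 2)) (by
        field_simp
        linear_combination (y 0 ^ 2 + y 1 ^ 2) * hw)
    refine ⟨a, ?_⟩
    ext i
    fin_cases i
    · change y' 0 = turn a y 0
      rw [turn_zero, ha, ha']
      field_simp
      ring
    · change y' 1 = turn a y 1
      rw [turn_one, ha, ha']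
      field_simp
      ring
    · change y' 2 = turn a y 2
      rw [turn_two, ha, ha']
      field_simp
      linear_combination -y' 2 * hw - y' 0 / 2 * h₀ - y' 1 / 2 * h₁
    · change y' 3 = turn a y 3
      rw [turn_three, ha, ha']
      field_simp
      linear_combination -y' 3 * hw - y' 0 / 2 * h₁ + y' 1 / 2 * h₀

/-- A preimage can be sought with v = t > 0 real: then t² = (1 + s m₂)/2 and w = (m₀ + i m₁)/(2t).
This fails only at the pole −s, where v = 0. -/
theorem hopf_surjective : Surjective c.hopf := by
  rintro ⟨m, hm⟩
  have hm' := mem_sphere_E3.1 hm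
  have hs := c.s_sq
  by_cases h : 1 + c.s * m 2 = 0
  · have h₂ : m 2 = -c.s := by linear_combination c.s * h - m 2 * hs
    have h₃ : m 0 ^ 2 + m 1 ^ 2 = 0 := by rw [h₂] at hm'; linarith
    have h₀ : m 0 = 0 := by nlinarith [sq_nonneg (m 0), sq_nonneg (m 1)]
    have h₁ : m 1 = 0 := by nlinarith [sq_nonneg (m 0), sq_nonneg (m 1)]
    refine ⟨⟨!₂[1, 0, 0, 0], mem_sphere_E4.2 (by simp)⟩, Subtype.ext ?_⟩
    ext i
    fin_cases i <;> simp [hopf, hopfAmb, h₀, h₁, h₂]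
  · have hp : 0 < 1 + c.s * m 2 := by
      have : (c.s * m 2) ^ 2 ≤ 1 := by
        rw [mul_pow, hs]; nlinarith [sq_nonneg (m 0), sq_nonneg (m 1)]
      have := (sq_le_one_iff_abs_le_one _).1 this
      exact lt_of_le_of_ne (by linarith [(abs_le.1 this).1]) (Ne.symm h)
    have ht := Real.sq_sqrt (half_pos hp).le
    have ht₀ := (Real.sqrt_pos.2 (half_pos hp)).ne'
    set t := √((1 + c.s * m 2) / 2)
    have hm₁ : (m 0 ^ 2 + m 1 ^ 2) / (4 * t ^ 2) = (1 - c.s * m 2) / 2 := by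
      rw [ht]
      field_simp
      linear_combination 4 * hm' + 4 * m 2 ^ 2 * hs
    refine ⟨⟨!₂[m 0 / (2 * t), m 1 / (2 * t), t, 0], mem_sphere_E4.2 ?_⟩, Subtype.ext ?_⟩
    · change (m 0 / (2 * t)) ^ 2 + (m 1 / (2 * t)) ^ 2 + t ^ 2 + 0 ^ 2 = 1
      linear_combination hm₁ + ht
    · ext i
      fin_cases i
      · change 2 * (m 0 / (2 * t) * t - m 1 / (2 * t) * 0) = m 0
        field_simp
        ring
      · change 2 * (m 0 / (2 * t) * 0 + m 1 / (2 * t) * t) = m 1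
        field_simp
        ring
      · change c.s * (t ^ 2 + 0 ^ 2 - (m 0 / (2 * t)) ^ 2 - (m 1 / (2 * t)) ^ 2) = m 2
        linear_combination c.s * ht - c.s * hm₁ + m 2 * hs

end Cap

/-! ### Tangent vectors of spheres in coordinates -/

/-- The differential of the inclusion of the three-sphere. -/
def incl3 (y : S3) : TangentSpace (𝓡 3) y →L[ℝ] E4 :=
  mfderiv (𝓡 3) 𝓘(ℝ, E4) (Subtype.val : S3 → E4) y

/-- The differential of the inclusion of the two-sphere. -/
def incl2 (x : S2) : TangentSpace (𝓡 2) x →L[ℝ] E3 :=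
  mfderiv (𝓡 2) (𝓡 3) (Subtype.val : S2 → E3) x

theorem incl2_injective (x : S2) : Injective (incl2 x) :=
  injective_mvfderiv_subtypeVal_sphere x

theorem incl3_injective (y : S3) : Injective (incl3 y) :=
  injective_mvfderiv_subtypeVal_sphere y

theorem range_incl3 (y : S3) : (incl3 y).range = (Submodule.span ℝ {(y : E4)})ᗮ :=
  range_mvfderiv_subtypeVal y

theorem range_incl2 (x : S2) : (incl2 x).range = (Submodule.span ℝ {(x : E3)})ᗮ :=
  range_mvfderiv_subtypeVal x

theorem incl3_orthogonal (y : S3) (v : TangentSpace (𝓡 3) y) :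
    (y : E4) 0 * incl3 y v 0 + (y : E4) 1 * incl3 y v 1 + (y : E4) 2 * incl3 y v 2 +
      (y : E4) 3 * incl3 y v 3 = 0 := by
  have h : incl3 y v ∈ (incl3 y).range := ⟨v, rfl⟩
  rw [range_incl3, Submodule.mem_orthogonal_singleton_iff_inner_right] at h
  simpa [PiLp.inner_apply, Fin.sum_univ_four, mul_comm] using h

theorem incl2_orthogonal (x : S2) (v : TangentSpace (𝓡 2) x) :
    (x : E3) 0 * incl2 x v 0 + (x : E3) 1 * incl2 x v 1 + (x : E3) 2 * incl2 x v 2 = 0 := by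
  have h : incl2 x v ∈ (incl2 x).range := ⟨v, rfl⟩
  rw [range_incl2, Submodule.mem_orthogonal_singleton_iff_inner_right] at h
  simpa [PiLp.inner_apply, Fin.sum_univ_three, mul_comm] using h

theorem exists_incl3_eq {y : S3} {V : E4}
    (h : (y : E4) 0 * V 0 + (y : E4) 1 * V 1 + (y : E4) 2 * V 2 + (y : E4) 3 * V 3 = 0) :
    ∃ v, incl3 y v = V := by
  change V ∈ (incl3 y).range
  rw [range_incl3, Submodule.mem_orthogonal_singleton_iff_inner_right]
  simpa [PiLp.inner_apply, Fin.sum_univ_four, mul_comm] using h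

/-- The differential of a map of spheres that is induced by a map of the ambient spaces. -/
theorem incl2_mfderiv {f : S3 → S2} {g : E4 → E3} (hfg : ∀ y : S3, (f y : E3) = g y) {y : S3}
    (hf : MDifferentiableAt (𝓡 3) (𝓡 2) f y) (hg : DifferentiableAt ℝ g y)
    (v : TangentSpace (𝓡 3) y) :
    incl2 (f y) (mfderiv (𝓡 3) (𝓡 2) f y v) = fderiv ℝ g y (incl3 y v) := by
  have h₂ : MDifferentiableAt (𝓡 2) (𝓡 3) (Subtype.val : S2 → E3) (f y) :=
    (contMDiff_coe_sphere (m := 1) (f y)).mdifferentiableAt one_ne_zero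
  have h₃ : MDifferentiableAt (𝓡 3) 𝓘(ℝ, E4) (Subtype.val : S3 → E4) y :=
    (contMDiff_coe_sphere (m := 1) y).mdifferentiableAt one_ne_zero
  have e₁ := mfderiv_comp y h₂ hf
  have e₂ := mfderiv_comp y (I' := 𝓘(ℝ, E4)) (I'' := 𝓡 3) hg.mdifferentiableAt h₃
  have e : (Subtype.val : S2 → E3) ∘ f = g ∘ (Subtype.val : S3 → E4) := funext hfg
  rw [e, e₂] at e₁
  have := congrArg (fun L : TangentSpace (𝓡 3) y →L[ℝ] E3 => L v) e₁
  rw [mfderiv_eq_fderiv] at this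
  exact this.symm

theorem areaForm_apply (x : S2) (v : Fin 2 → TangentSpace (𝓡 2) x) :
    areaForm x v =
      (x : E3) 0 * (incl2 x (v 0) 1 * incl2 x (v 1) 2 - incl2 x (v 1) 1 * incl2 x (v 0) 2) +
      (x : E3) 1 * (incl2 x (v 0) 2 * incl2 x (v 1) 0 - incl2 x (v 1) 2 * incl2 x (v 0) 0) +
      (x : E3) 2 * (incl2 x (v 0) 0 * incl2 x (v 1) 1 - incl2 x (v 1) 0 * incl2 x (v 0) 1) :=
  rfl

/-- A component of a derivative, computed along a line. -/
theorem fderiv_apply_eq_of_hasDerivAt {g : E4 → E3} {y V : E4} (hg : DifferentiableAt ℝ g y)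
    (i : Fin 3) {D : ℝ} (h : HasDerivAt (fun t : ℝ => g (y + t • V) i) D 0) :
    fderiv ℝ g y V i = D := by
  have h₁ : HasDerivAt (fun t : ℝ => g (y + t • V)) (fderiv ℝ g y V) 0 :=
    hg.hasFDerivAt.hasLineDerivAt V
  exact ((EuclideanSpace.proj (𝕜 := ℝ) i).hasFDerivAt.comp_hasDerivAt 0 h₁).unique h

theorem hasDerivAt_coord (y V : E4) (i : Fin 4) :
    HasDerivAt (fun t : ℝ => (y + t • V) i) (V i) 0 := by
  have := ((hasDerivAt_id (0 : ℝ)).mul_const (V i)).const_add (y i)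
  simpa using this

/-! ### Smoothness of the two maps, and pullbacks of the forms to the three-sphere. -/

namespace Cap

variable (c : Cap)

theorem contDiff_hopfAmb : ContDiff ℝ ∞ c.hopfAmb := by
  refine contDiff_euclidean.2 fun i => ?_
  fin_cases i
  · change ContDiff ℝ ∞ fun y : E4 => 2 * (y 0 * y 2 - y 1 * y 3)
    fun_prop
  · change ContDiff ℝ ∞ fun y : E4 => 2 * (y 0 * y 3 + y 1 * y 2)
    fun_prop
  · change ContDiff ℝ ∞ fun y : E4 => c.s * (y 2 ^ 2 + y 3 ^ 2 - y 0 ^ 2 - y 1 ^ 2)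
    fun_prop

theorem contDiffAt_rad (y : S3) : ContDiffAt ℝ ∞ c.rad y :=
  ContDiffAt.sqrt (by fun_prop) (rad_arg_pos y).ne'

theorem contDiffAt_capAmb (y : S3) : ContDiffAt ℝ ∞ c.capAmb y := by
  have h := c.contDiffAt_rad y
  refine contDiffAt_euclidean.2 fun i => ?_
  fin_cases i
  · change ContDiffAt ℝ ∞ (fun y : E4 => y 0 * c.rad y) y
    fun_prop
  · change ContDiffAt ℝ ∞ (fun y : E4 => y 1 * c.rad y) y
    fun_prop
  · change ContDiffAt ℝ ∞ (fun y : E4 => c.s * (1 - c.R * (y 0 ^ 2 + y 1 ^ 2))) y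
    fun_prop

/-- The complex component of the parametrization, as a linear map. -/
def capCL : E4 →L[ℝ] ℂ :=
  LinearMap.toContinuousLinearMap
    { toFun := c.capC
      map_add' := fun x y => by apply Complex.ext <;> simp [capC] <;> ring
      map_smul' := fun a x => by apply Complex.ext <;> simp [capC] <;> ring }

theorem contDiff_capC : ContDiff ℝ ∞ c.capC := c.capCL.contDiff

theorem contMDiff_hopf : ContMDiff (𝓡 3) (𝓡 2) ∞ c.hopf :=
  ContMDiff.codRestrict_sphere
    (c.contDiff_hopfAmb.contMDiff.comp contMDiff_coe_sphere) hopfAmb_mem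

theorem contMDiff_cap_fst : ContMDiff (𝓡 3) (𝓡 2) ∞ fun y => (c.cap y).1 :=
  ContMDiff.codRestrict_sphere (f := fun y : S3 => c.capAmb y) (fun y =>
    (c.contDiffAt_capAmb y).contMDiffAt.comp y contMDiff_coe_sphere.contMDiffAt) capAmb_mem

theorem contMDiff_cap_snd : ContMDiff (𝓡 3) 𝓘(ℝ, ℂ) ∞ fun y => (c.cap y).2 :=
  c.contDiff_capC.contMDiff.comp contMDiff_coe_sphere

theorem contMDiff_cap : ContMDiff (𝓡 3) ((𝓡 2).prod 𝓘(ℝ, ℂ)) ∞ c.cap :=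
  c.contMDiff_cap_fst.prodMk c.contMDiff_cap_snd

theorem fderiv_hopfAmb (y V : E4) :
    fderiv ℝ c.hopfAmb y V 0 = 2 * (V 0 * y 2 + y 0 * V 2 - (V 1 * y 3 + y 1 * V 3)) ∧
    fderiv ℝ c.hopfAmb y V 1 = 2 * (V 0 * y 3 + y 0 * V 3 + (V 1 * y 2 + y 1 * V 2)) ∧
    fderiv ℝ c.hopfAmb y V 2 =
      c.s * (2 * y 2 * V 2 + 2 * y 3 * V 3 - 2 * y 0 * V 0 - 2 * y 1 * V 1) := by
  have hd := c.contDiff_hopfAmb.differentiable (by simp) y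
  have hc := hasDerivAt_coord y V
  refine ⟨fderiv_apply_eq_of_hasDerivAt hd 0 ?_, fderiv_apply_eq_of_hasDerivAt hd 1 ?_,
    fderiv_apply_eq_of_hasDerivAt hd 2 ?_⟩
  · have h := (((hc 0).mul (hc 2)).sub ((hc 1).mul (hc 3))).const_mul 2
    refine h.congr_deriv ?_
    simp
  · have h := (((hc 0).mul (hc 3)).add ((hc 1).mul (hc 2))).const_mul 2
    refine h.congr_deriv ?_
    simp
  · have h := (((((hc 2).pow 2).add ((hc 3).pow 2)).sub ((hc 0).pow 2)).sub
      ((hc 1).pow 2)).const_mul c.s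
    refine h.congr_deriv ?_
    simp

/-- The differential of the Hopf map is surjective: up to a factor, a right inverse is given by
the transposed differential. -/
theorem mfderiv_hopf_surjective (y : S3) : Surjective (mfderiv (𝓡 3) (𝓡 2) c.hopf y) := by
  intro w
  have hy := mem_sphere_E4.1 y.2
  have hs := c.s_sq
  set W := incl2 (c.hopf y) w with hW
  have hWo := incl2_orthogonal (c.hopf y) w
  rw [← hW] at hWo
  change c.hopfAmb y 0 * W 0 + c.hopfAmb y 1 * W 1 + c.hopfAmb y 2 * W 2 = 0 at hWo
  simp only [hopfAmb_zero, hopfAmb_one, hopfAmb_two] at hWo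
  obtain ⟨y, hyy⟩ := y
  simp only at hy hWo
  -- This is a quarter of the transposed differential applied to `W`: on the unit sphere the rows of
  -- the differential are orthogonal of squared length 4. Moreover ⟨y, V⟩ = ⟨hopf y, W⟩ / 2 = 0, so
  -- `V` is tangent.
  let V : E4 := !₂[(y 2 * W 0 + y 3 * W 1 - c.s * y 0 * W 2) / 2,
    (-y 3 * W 0 + y 2 * W 1 - c.s * y 1 * W 2) / 2,
    (y 0 * W 0 + y 1 * W 1 + c.s * y 2 * W 2) / 2,
    (-y 1 * W 0 + y 0 * W 1 + c.s * y 3 * W 2) / 2]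
  have V0 : V 0 = (y 2 * W 0 + y 3 * W 1 - c.s * y 0 * W 2) / 2 := rfl
  have V1 : V 1 = (-y 3 * W 0 + y 2 * W 1 - c.s * y 1 * W 2) / 2 := rfl
  have V2 : V 2 = (y 0 * W 0 + y 1 * W 1 + c.s * y 2 * W 2) / 2 := rfl
  have V3 : V 3 = (-y 1 * W 0 + y 0 * W 1 + c.s * y 3 * W 2) / 2 := rfl
  obtain ⟨v, hv⟩ := exists_incl3_eq (y := ⟨y, hyy⟩) (V := V) (by
    simp only [V0, V1, V2, V3]
    linear_combination hWo / 2)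
  refine ⟨v, incl2_injective _ ?_⟩
  rw [incl2_mfderiv (g := c.hopfAmb) (fun _ => rfl)
    (c.contMDiff_hopf.mdifferentiable (by simp) _) (c.contDiff_hopfAmb.differentiable (by simp) _),
    hv]
  obtain ⟨h₀, h₁, h₂⟩ := c.fderiv_hopfAmb y V
  change fderiv ℝ c.hopfAmb y V = W
  ext i
  fin_cases i
  · change fderiv ℝ c.hopfAmb y V 0 = W 0
    rw [h₀, V0, V1, V2, V3]
    linear_combination W 0 * hy
  · change fderiv ℝ c.hopfAmb y V 1 = W 1
    rw [h₁, V0, V1, V2, V3]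
    linear_combination W 1 * hy
  · change fderiv ℝ c.hopfAmb y V 2 = W 2
    rw [h₂, V0, V1, V2, V3]
    linear_combination W 2 * hy + (y 0 ^ 2 + y 1 ^ 2 + y 2 ^ 2 + y 3 ^ 2) * W 2 * hs

/-- `D` is the differential of `rad`. It is described only through `rad * D`, half the differential
of `rad ^ 2`, so that the area computation becomes polynomial. -/
theorem exists_fderiv_capAmb (y : S3) : ∃ D : E4 → ℝ, ∀ V : E4,
    c.rad y * D V = -c.R ^ 2 * ((y : E4) 0 * V 0 + (y : E4) 1 * V 1) ∧
    fderiv ℝ c.capAmb y V 0 = V 0 * c.rad y + (y : E4) 0 * D V ∧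
    fderiv ℝ c.capAmb y V 1 = V 1 * c.rad y + (y : E4) 1 * D V ∧
    fderiv ℝ c.capAmb y V 2 = -2 * c.s * c.R * ((y : E4) 0 * V 0 + (y : E4) 1 * V 1) := by
  refine ⟨fun V => fderiv ℝ c.rad y V, fun V => ?_⟩
  have hd := (c.contDiffAt_capAmb y).differentiableAt (by simp)
  have hc := hasDerivAt_coord (y : E4) V
  have hr : HasDerivAt (fun t : ℝ => c.rad ((y : E4) + t • V)) (fderiv ℝ c.rad y V) 0 :=
    ((c.contDiffAt_rad y).differentiableAt (by simp)).hasFDerivAt.hasLineDerivAt V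
  have hq := (((((hc 0).pow 2).add ((hc 1).pow 2)).const_mul c.R))
  refine ⟨?_, fderiv_apply_eq_of_hasDerivAt hd 0 ?_, fderiv_apply_eq_of_hasDerivAt hd 1 ?_,
    fderiv_apply_eq_of_hasDerivAt hd 2 ?_⟩
  · have h₁ := (hq.const_sub 2).const_mul c.R
    have h₀ := rad_arg_pos (c := c) y
    have h₂ := h₁.sqrt (by simpa using h₀.ne')
    have h₃ := hr.unique h₂
    have h₄ : √(c.R * (2 - c.R * ((y : E4) 0 ^ 2 + (y : E4) 1 ^ 2))) ≠ 0 := (rad_pos y).ne'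
    simp only [h₃]
    simp [rad]
    field_simp
  · refine ((hc 0).mul hr).congr_deriv ?_
    simp
  · refine ((hc 1).mul hr).congr_deriv ?_
    simp
  · refine ((hq.const_sub 1).const_mul c.s).congr_deriv ?_
    simp
    ring

/-- The Hopf map pulls the area form back to four times a difference of coordinate forms. -/
theorem areaForm_hopf (y : S3) (v : Fin 2 → TangentSpace (𝓡 3) y) :
    areaForm (c.hopf y) (fun i => mfderiv (𝓡 3) (𝓡 2) c.hopf y (v i)) =
      4 * c.s * (incl3 y (v 0) 0 * incl3 y (v 1) 1 - incl3 y (v 1) 0 * incl3 y (v 0) 1 -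
        (incl3 y (v 0) 2 * incl3 y (v 1) 3 - incl3 y (v 1) 2 * incl3 y (v 0) 3)) := by
  have hy := mem_sphere_E4.1 y.2
  have h (i) : incl2 (c.hopf y) (mfderiv (𝓡 3) (𝓡 2) c.hopf y (v i)) =
      fderiv ℝ c.hopfAmb y (incl3 y (v i)) :=
    incl2_mfderiv (g := c.hopfAmb) (fun _ => rfl)
      (c.contMDiff_hopf.mdifferentiable (by simp) _)
      (c.contDiff_hopfAmb.differentiable (by simp) _) (v i)
  have ho := incl3_orthogonal y
  rw [areaForm_apply]
  simp only [h, c.fderiv_hopfAmb]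
  generalize hV : incl3 y (v 0) = V
  generalize hU : incl3 y (v 1) = U
  have hoV := ho (v 0)
  have hoU := ho (v 1)
  rw [hV] at hoV
  rw [hU] at hoU
  change c.hopfAmb y 0 * _ + c.hopfAmb y 1 * _ + c.hopfAmb y 2 * _ = _
  simp only [hopfAmb_zero, hopfAmb_one, hopfAmb_two]
  generalize (y : E4) = z at *
  -- With Ω = dy₀ ∧ dy₁ − dy₂ ∧ dy₃, the left side equals 4s|y|²(|y|² Ω(V, U) − ⟨y, V⟩ Ω(y, U) + ⟨y,
  -- U⟩ Ω(y, V)) on all of ℝ⁴.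
  linear_combination
    4 * c.s * (z 0 ^ 2 + z 1 ^ 2 + z 2 ^ 2 + z 3 ^ 2 + 1) *
      (V 0 * U 1 - U 0 * V 1 - (V 2 * U 3 - U 2 * V 3)) * hy -
    4 * c.s * (z 0 ^ 2 + z 1 ^ 2 + z 2 ^ 2 + z 3 ^ 2) *
      (z 0 * U 1 - U 0 * z 1 - (z 2 * U 3 - U 2 * z 3)) * hoV +
    4 * c.s * (z 0 ^ 2 + z 1 ^ 2 + z 2 ^ 2 + z 3 ^ 2) *
      (z 0 * V 1 - V 0 * z 1 - (z 2 * V 3 - V 2 * z 3)) * hoU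

/-- In cylindrical coordinates A = dθ ∧ dz, and z = s(1 − Rρ²) turns this into 2sR ρ dρ ∧ dθ. -/
theorem areaForm_cap (y : S3) (v : Fin 2 → TangentSpace (𝓡 3) y) :
    areaForm (c.cap y).1 (fun i => mfderiv (𝓡 3) (𝓡 2) (fun y => (c.cap y).1) y (v i)) =
      2 * c.s * c.R * (incl3 y (v 0) 0 * incl3 y (v 1) 1 - incl3 y (v 1) 0 * incl3 y (v 0) 1) := by
  have hF := rad_sq (c := c) y
  have h (i) : incl2 (c.cap y).1 (mfderiv (𝓡 3) (𝓡 2) (fun y => (c.cap y).1) y (v i)) =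
      fderiv ℝ c.capAmb y (incl3 y (v i)) :=
    incl2_mfderiv (g := c.capAmb) (f := fun y => (c.cap y).1) (fun _ => rfl)
      (c.contMDiff_cap_fst.mdifferentiable (by simp) _)
      ((c.contDiffAt_capAmb y).differentiableAt (by simp)) (v i)
  obtain ⟨D, hD⟩ := c.exists_fderiv_capAmb y
  rw [areaForm_apply]
  simp only [h, (hD _).2]
  generalize hV : incl3 y (v 0) = V
  generalize hU : incl3 y (v 1) = U
  have hDV := (hD V).1
  have hDU := (hD U).1
  change c.capAmb y 0 * _ + c.capAmb y 1 * _ + c.capAmb y 2 * _ = _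
  simp only [capAmb_zero, capAmb_one, capAmb_two]
  generalize (y : E4) = z at *
  linear_combination
    (-2 * c.s * c.R * ((z 0 * U 0 + z 1 * U 1) * (z 0 * V 1 - z 1 * V 0) -
        (z 0 * V 0 + z 1 * V 1) * (z 0 * U 1 - z 1 * U 0)) +
      c.s * (1 - c.R * (z 0 ^ 2 + z 1 ^ 2)) * (V 0 * U 1 - U 0 * V 1)) * hF +
    c.s * (1 - c.R * (z 0 ^ 2 + z 1 ^ 2)) * (z 0 * U 1 - z 1 * U 0) * hDV -
    c.s * (1 - c.R * (z 0 ^ 2 + z 1 ^ 2)) * (z 0 * V 1 - z 1 * V 0) * hDU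

theorem omegaC_cap (y : S3) (v : Fin 2 → TangentSpace (𝓡 3) y) :
    omegaC (c.cap y).2 (fun i => mfderiv (𝓡 3) 𝓘(ℝ, ℂ) (fun y => (c.cap y).2) y (v i)) =
      -2 * c.K * c.sgn *
        (incl3 y (v 0) 2 * incl3 y (v 1) 3 - incl3 y (v 1) 2 * incl3 y (v 0) 3) := by
  have hK := Real.sq_sqrt c.K_pos.le
  have h₃ : MDifferentiableAt (𝓡 3) 𝓘(ℝ, E4) (Subtype.val : S3 → E4) y :=
    (contMDiff_coe_sphere (m := 1) y).mdifferentiableAt one_ne_zero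
  have e := mfderiv_comp y (I' := 𝓘(ℝ, E4)) (I'' := 𝓘(ℝ, ℂ)) (g := c.capCL)
    c.capCL.differentiableAt.mdifferentiableAt h₃
  have h (i) : mfderiv (𝓡 3) 𝓘(ℝ, ℂ) (fun y => (c.cap y).2) y (v i) = c.capC (incl3 y (v i)) := by
    have h₁ := congrArg (fun L : TangentSpace (𝓡 3) y →L[ℝ] ℂ => L (v i)) e
    rw [mfderiv_eq_fderiv, ContinuousLinearMap.fderiv] at h₁
    exact h₁
  simp only [h]
  change -2 * (√c.K * incl3 y (v 0) 2 * (√c.K * (c.sgn * incl3 y (v 1) 3)) -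
    √c.K * incl3 y (v 1) 2 * (√c.K * (c.sgn * incl3 y (v 0) 3))) = _
  linear_combination -2 * c.sgn *
    (incl3 y (v 0) 2 * incl3 y (v 1) 3 - incl3 y (v 1) 2 * incl3 y (v 0) 3) * hK

end Cap

/-! ### Functoriality and injectivity of the pullback. -/

theorem TwoForm.pullback_comp {E H M E' H' M' E'' H'' M'' : Type*}
    [NormedAddCommGroup E] [NormedSpace ℝ E] [TopologicalSpace H]
    [TopologicalSpace M] [ChartedSpace H M]
    [NormedAddCommGroup E'] [NormedSpace ℝ E'] [TopologicalSpace H']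
    [TopologicalSpace M'] [ChartedSpace H' M']
    [NormedAddCommGroup E''] [NormedSpace ℝ E''] [TopologicalSpace H'']
    [TopologicalSpace M''] [ChartedSpace H'' M'']
    {I : ModelWithCorners ℝ E H} {I' : ModelWithCorners ℝ E' H'} {I'' : ModelWithCorners ℝ E'' H''}
    {g : M' → M''} {f : M → M'} (om : TwoForm I'' M'') (hg : MDifferentiable I' I'' g)
    (hf : MDifferentiable I I' f) :
    TwoForm.pullback (I := I) (g ∘ f) om =
      TwoForm.pullback (I := I) f (TwoForm.pullback (I := I') g om) := by
  funext x
  simp only [TwoForm.pullback]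
  rw [mfderiv_comp x (hg _) (hf x)]
  rfl

/-- The pullback along a surjective map with surjective differential is injective. -/
theorem TwoForm.pullback_injective {E H M E' H' M' : Type*}
    [NormedAddCommGroup E] [NormedSpace ℝ E] [TopologicalSpace H]
    [TopologicalSpace M] [ChartedSpace H M]
    [NormedAddCommGroup E'] [NormedSpace ℝ E'] [TopologicalSpace H']
    [TopologicalSpace M'] [ChartedSpace H' M']
    {I : ModelWithCorners ℝ E H} {I' : ModelWithCorners ℝ E' H'} {f : M → M'} (hf : Surjective f)
    (hf' : ∀ x, Surjective (mfderiv I I' f x)) :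
    Injective (TwoForm.pullback (I := I) (I' := I') f) := by
  intro om om' h
  funext y
  obtain ⟨x, rfl⟩ := hf y
  ext v
  choose w hw using fun i => hf' x (v i)
  have h₁ := congrArg (fun η : (TangentSpace I x) [⋀^Fin 2]→L[ℝ] ℝ => η w) (congrFun h x)
  have h₂ : (fun i => mfderiv I I' f x (w i)) = v := funext hw
  change om (f x) (fun i => mfderiv I I' f x (w i)) =
    om' (f x) (fun i => mfderiv I I' f x (w i)) at h₁
  rwa [h₂] at h₁

namespace Cap

variable (c : Cap)

/-- By `hn` the coefficients of dy₀ ∧ dy₁ and dy₂ ∧ dy₃ are nsR and −nsR. Comparison with (c/2) · 4s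
in `areaForm_hopf` gives c = nR/2. -/
theorem pullback_cap_sumForm {n : ℝ} (hn : 2 * c.K = c.sgn * n * c.s * c.R) :
    TwoForm.pullback (I := 𝓡 3) c.cap (sumForm (omegaS2 n)) =
      TwoForm.pullback (I := 𝓡 3) c.hopf (omegaS2 (n * c.R / 2)) := by
  have hs := c.sgn_sq
  have hd : MDifferentiable (𝓡 3) ((𝓡 2).prod 𝓘(ℝ, ℂ)) c.cap :=
    c.contMDiff_cap.mdifferentiable (by simp)
  have h₁ := TwoForm.pullback_comp (I := 𝓡 3) (I' := (𝓡 2).prod 𝓘(ℝ, ℂ)) (omegaS2 n)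
    (g := Prod.fst) (f := c.cap) (fun _ => mdifferentiableAt_fst) hd
  have h₂ := TwoForm.pullback_comp (I := 𝓡 3) (I' := (𝓡 2).prod 𝓘(ℝ, ℂ)) omegaC
    (g := Prod.snd) (f := c.cap) (fun _ => mdifferentiableAt_snd) hd
  have h₃ : TwoForm.pullback (I := 𝓡 3) c.cap (sumForm (omegaS2 n)) =
      TwoForm.pullback (I := 𝓡 3) (Prod.fst ∘ c.cap) (omegaS2 n) +
      TwoForm.pullback (I := 𝓡 3) (Prod.snd ∘ c.cap) omegaC := by
    rw [h₁, h₂]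
    rfl
  rw [h₃]
  funext y
  ext v
  change n / 2 * areaForm (c.cap y).1
      (fun i => mfderiv (𝓡 3) (𝓡 2) (fun y => (c.cap y).1) y (v i)) +
    omegaC (c.cap y).2 (fun i => mfderiv (𝓡 3) 𝓘(ℝ, ℂ) (fun y => (c.cap y).2) y (v i)) =
    n * c.R / 2 / 2 * areaForm (c.hopf y) (fun i => mfderiv (𝓡 3) (𝓡 2) c.hopf y (v i))
  rw [areaForm_cap, omegaC_cap, areaForm_hopf]
  linear_combination
    (incl3 y (v 0) 2 * incl3 y (v 1) 3 - incl3 y (v 1) 2 * incl3 y (v 0) 3) *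
      (-c.sgn * hn - n * c.s * c.R * hs)

theorem sgn_mul_zpow (a : Circle) (u : ℂ) :
    ((((a ^ (-(c.ε : ℤ)) : Circle) : ℂ) * u).re = (a : ℂ).re * u.re + c.sgn * (a : ℂ).im * u.im) ∧
    ((((a ^ (-(c.ε : ℤ)) : Circle) : ℂ) * u).im =
      (a : ℂ).re * u.im - c.sgn * (a : ℂ).im * u.re) := by
  rcases Int.units_eq_one_or c.ε with h | h
  · constructor <;> simp [sgn, h, sub_eq_add_neg]
  · constructor <;> simp [sgn, h, sub_eq_add_neg]

/-- The sign in `coord` conjugates u when ε = −1, so both cut actions become the single action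
`turn`. -/
theorem coord_rot (a : Circle) (m : E3) (u : ℂ) :
    c.coord (rot a m) (((a ^ (-(c.ε : ℤ)) : Circle) : ℂ) * u) = turn a (c.coord m u) := by
  obtain ⟨h₁, h₂⟩ := c.sgn_mul_zpow a u
  have hs := c.sgn_sq
  ext i
  fin_cases i
  · change ((a : ℂ).re * m 0 - (a : ℂ).im * m 1) / √(c.R * (1 + c.s * m 2)) = turn a _ 0
    rw [turn_zero, coord_zero, coord_one]
    ring
  · change ((a : ℂ).im * m 0 + (a : ℂ).re * m 1) / √(c.R * (1 + c.s * m 2)) = turn a _ 1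
    rw [turn_one, coord_zero, coord_one]
    ring
  · change c.coord _ _ 2 = turn a _ 2
    rw [turn_two, coord_two, coord_two, coord_three, h₁]
    ring
  · change c.coord _ _ 3 = turn a _ 3
    rw [turn_three, coord_three, coord_two, coord_three, h₂]
    linear_combination -(a : ℂ).im * u.re / √c.K * hs

variable {c}

theorem IsLevel.rot {m : E3} {u : ℂ} (h : c.IsLevel m u) (a b : Circle) :
    c.IsLevel (SphereCut.rot a m) (b * u) := by
  rw [IsLevel, norm_mul, Circle.norm_coe, one_mul]
  exact h

theorem contDiffAt_coord {p : E3 × ℂ} (hp : 0 < 1 + c.s * p.1 2) :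
    ContDiffAt ℝ ∞ (fun p : E3 × ℂ => c.coord p.1 p.2) p := by
  have hR := mul_pos c.R_pos hp
  have h₁ : ContDiffAt ℝ ∞ (fun p : E3 × ℂ => √(c.R * (1 + c.s * p.1 2))) p :=
    ContDiffAt.sqrt (by fun_prop) hR.ne'
  have h₂ := (Real.sqrt_pos.2 hR).ne'
  have hre : ContDiff ℝ ∞ fun p : E3 × ℂ => p.2.re := Complex.reCLM.contDiff.comp contDiff_snd
  have him : ContDiff ℝ ∞ fun p : E3 × ℂ => p.2.im := Complex.imCLM.contDiff.comp contDiff_snd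
  refine contDiffAt_euclidean.2 fun i => ?_
  fin_cases i
  · change ContDiffAt ℝ ∞ (fun p : E3 × ℂ => p.1 0 / √(c.R * (1 + c.s * p.1 2))) p
    exact ContDiffAt.div (by fun_prop) h₁ h₂
  · change ContDiffAt ℝ ∞ (fun p : E3 × ℂ => p.1 1 / √(c.R * (1 + c.s * p.1 2))) p
    exact ContDiffAt.div (by fun_prop) h₁ h₂
  · change ContDiffAt ℝ ∞ (fun p : E3 × ℂ => p.2.re / √c.K) p
    exact (hre.div_const _).contDiffAt
  · change ContDiffAt ℝ ∞ (fun p : E3 × ℂ => c.sgn * p.2.im / √c.K) p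
    exact ((contDiff_const.mul him).div_const _).contDiffAt

theorem contMDiffAt_coord {p : S2 × ℂ} (hp : 0 < 1 + c.s * (p.1 : E3) 2) :
    ContMDiffAt ((𝓡 2).prod 𝓘(ℝ, ℂ)) 𝓘(ℝ, E4) ∞ (fun p : S2 × ℂ => c.coord p.1 p.2) p := by
  have h₁ : ContMDiff ((𝓡 2).prod 𝓘(ℝ, ℂ)) 𝓘(ℝ, E3 × ℂ) ∞
      fun p : S2 × ℂ => ((p.1 : E3), p.2) :=
    (contMDiff_coe_sphere.comp contMDiff_fst).prodMk_space contMDiff_snd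
  exact ContMDiffAt.comp (I' := 𝓘(ℝ, E3 × ℂ)) (g := fun q : E3 × ℂ => c.coord q.1 q.2) p
    (contDiffAt_coord hp).contMDiffAt h₁.contMDiffAt

variable {Φ : S2 → ℝ} {α : ℝ}

/-- The level set is a three-sphere. -/
def levelHomeo (hΦ : ∀ (m : S2) (u : ℂ), Φ m - ((c.ε : ℤ) : ℝ) * ‖u‖ ^ 2 = α ↔ c.IsLevel m u) :
    Level Φ α c.ε ≃ₜ S3 where
  toFun p := ⟨c.coord p.1.1 p.1.2, coord_mem p.1.1.2 ((hΦ _ _).1 p.2)⟩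
  invFun y := ⟨c.cap y, (hΦ _ _).2 (isLevel_cap y)⟩
  left_inv p := Subtype.ext (Prod.ext
    (Subtype.ext (capAmb_coord p.1.1.2 ((hΦ _ _).1 p.2))) (capC_coord _ _))
  right_inv y := Subtype.ext (coord_cap y)
  continuous_toFun := Continuous.subtype_mk (continuous_iff_continuousAt.2 fun p =>
    (contMDiffAt_coord ((hΦ _ _).1 p.2).pos).continuousAt.comp
      continuous_subtype_val.continuousAt) _
  continuous_invFun := c.contMDiff_cap.continuous.subtype_mk _

variable (hΦ : ∀ (m : S2) (u : ℂ), Φ m - ((c.ε : ℤ) : ℝ) * ‖u‖ ^ 2 = α ↔ c.IsLevel m u)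

theorem hopf_levelHomeo_eq_iff {p q : Level Φ α c.ε} :
    c.hopf (levelHomeo hΦ p) = c.hopf (levelHomeo hΦ q) ↔ cutMk Φ α c.ε p = cutMk Φ α c.ε q := by
  have hp := (hΦ _ _).1 p.2
  have hq := (hΦ _ _).1 q.2
  constructor
  · intro h
    obtain ⟨a, ha⟩ := exists_turn c h
    change c.coord q.1.1 q.1.2 = turn a (c.coord p.1.1 p.1.2) at ha
    rw [← coord_rot] at ha
    refine Quotient.sound ⟨a, Subtype.ext ?_, ?_⟩
    · have := congrArg c.capAmb ha
      rwa [capAmb_coord q.1.1.2 hq, capAmb_coord (rot_mem a p.1.1) (hp.rot a _)] at this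
    · have := congrArg c.capC ha
      rwa [capC_coord, capC_coord] at this
  · intro h
    obtain ⟨a, h₁, h₂⟩ : (orbitSetoid Φ α c.ε).r p q := Quotient.exact h
    refine Subtype.ext ?_
    change c.hopfAmb (c.coord p.1.1 p.1.2) = c.hopfAmb (c.coord q.1.1 q.1.2)
    have h₃ : (q.1.1 : E3) = rot a p.1.1 := congrArg Subtype.val h₁
    rw [h₂, h₃, coord_rot, hopfAmb_turn]

/-- The identification of the cut space with the sphere, induced by the Hopf map. -/
def cutEquiv : CutSpace Φ α c.ε ≃ S2 :=
  Equiv.ofBijective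
    (Quotient.lift (fun p => c.hopf (levelHomeo hΦ p))
      fun _ _ h => (hopf_levelHomeo_eq_iff hΦ).2 (Quotient.sound h)) (by
    constructor
    · rintro ⟨p⟩ ⟨q⟩ h
      exact (hopf_levelHomeo_eq_iff hΦ).1 h
    · intro m
      obtain ⟨y, hy⟩ := c.hopf_surjective m
      exact ⟨cutMk Φ α c.ε ((levelHomeo hΦ).symm y), by
        change c.hopf (levelHomeo hΦ ((levelHomeo hΦ).symm y)) = m
        rw [Homeomorph.apply_symm_apply, hy]⟩)

theorem cutEquiv_cutMk (p : Level Φ α c.ε) :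
    cutEquiv hΦ (cutMk Φ α c.ε p) = c.hopf (levelHomeo hΦ p) := rfl

theorem continuous_cutEquiv : Continuous (cutEquiv hΦ) :=
  Continuous.quotient_lift (c.contMDiff_hopf.continuous.comp (levelHomeo hΦ).continuous) _

/-- The identification of the cut space with the sphere, as a homeomorphism. -/
def cutHomeo : CutSpace Φ α c.ε ≃ₜ S2 :=
  -- Compactness of S³ passes to the quotient, and S² is Hausdorff, so the continuous bijection is a
  -- homeomorphism.
  haveI : CompactSpace (Level Φ α c.ε) := (levelHomeo hΦ).symm.compactSpace
  Continuous.homeoOfEquivCompactToT2 (continuous_cutEquiv hΦ)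

/-- Rotating m with u fixed multiplies w by a and fixes v; hence wv is multiplied by a and the
height is unchanged. -/
theorem cutEquiv_equivariant (a : Circle) (p q : Level Φ α c.ε) (h₁ : q.1.1 = a • p.1.1)
    (h₂ : q.1.2 = p.1.2) :
    cutEquiv hΦ (cutMk Φ α c.ε q) = a • cutEquiv hΦ (cutMk Φ α c.ε p) := by
  refine Subtype.ext ?_
  have h₃ : (q.1.1 : E3) = rot a p.1.1 := congrArg Subtype.val h₁
  change c.hopfAmb (c.coord q.1.1 q.1.2) = rot a (c.hopfAmb (c.coord p.1.1 p.1.2))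
  rw [h₂, h₃]
  generalize (p.1.1 : E3) = m
  generalize p.1.2 = u
  have e₀ : c.coord (rot a m) u 0 =
      (a : ℂ).re * c.coord m u 0 - (a : ℂ).im * c.coord m u 1 := by
    change ((a : ℂ).re * m 0 - (a : ℂ).im * m 1) / √(c.R * (1 + c.s * m 2)) = _
    rw [coord_zero, coord_one]
    ring
  have e₁ : c.coord (rot a m) u 1 =
      (a : ℂ).im * c.coord m u 0 + (a : ℂ).re * c.coord m u 1 := by
    change ((a : ℂ).im * m 0 + (a : ℂ).re * m 1) / √(c.R * (1 + c.s * m 2)) = _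
    rw [coord_zero, coord_one]
    ring
  have e₂ : c.coord (rot a m) u 2 = c.coord m u 2 := rfl
  have e₃ : c.coord (rot a m) u 3 = c.coord m u 3 := rfl
  have ha := circle_sq a
  generalize c.coord m u = y at *
  ext i
  fin_cases i
  · change c.hopfAmb _ 0 = (a : ℂ).re * c.hopfAmb y 0 - (a : ℂ).im * c.hopfAmb y 1
    rw [hopfAmb_zero, hopfAmb_zero, hopfAmb_one, e₀, e₁, e₂, e₃]
    ring
  · change c.hopfAmb _ 1 = (a : ℂ).im * c.hopfAmb y 0 + (a : ℂ).re * c.hopfAmb y 1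
    rw [hopfAmb_one, hopfAmb_zero, hopfAmb_one, e₀, e₁, e₂, e₃]
    ring
  · change c.hopfAmb _ 2 = c.hopfAmb y 2
    rw [hopfAmb_two, hopfAmb_two, e₀, e₁, e₂, e₃]
    linear_combination -c.s * (y 0 ^ 2 + y 1 ^ 2) * ha

/-! #### Smooth structures -/

section Smooth

variable [ChartedSpace (EuclideanSpace ℝ (Fin (2 + 1))) (Level Φ α c.ε)]

theorem contMDiff_levelHomeo [IsManifold (𝓡 (2 + 1)) ∞ (Level Φ α c.ε)]
    (h : ContMDiff (𝓡 (2 + 1)) ((𝓡 2).prod 𝓘(ℝ, ℂ)) ∞ (Subtype.val : Level Φ α c.ε → S2 × ℂ)) :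
    ContMDiff (𝓡 (2 + 1)) (𝓡 3) ∞ (levelHomeo hΦ) :=
  ContMDiff.codRestrict_sphere (f := fun p : Level Φ α c.ε => c.coord p.1.1 p.1.2)
    (fun p => (contMDiffAt_coord ((hΦ _ _).1 p.2).pos).comp p h.contMDiffAt)
    fun p => coord_mem p.1.1.2 ((hΦ _ _).1 p.2)

/-- Smoothness of a continuous map into the level set can be tested after the immersion into S² × ℂ,
where this map is `cap`. -/
theorem contMDiff_levelHomeo_symm
    (h : Manifold.IsSmoothEmbedding (𝓡 (2 + 1)) ((𝓡 2).prod 𝓘(ℝ, ℂ)) ∞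
      (Subtype.val : Level Φ α c.ε → S2 × ℂ)) :
    ContMDiff (𝓡 3) (𝓡 (2 + 1)) ∞ (levelHomeo hΦ).symm :=
  (ContMDiff.iff_comp_isImmersion h.isImmersion).2
    ⟨(levelHomeo hΦ).symm.continuous, c.contMDiff_cap⟩

/-- The formula `coord` is smooth near the level set in S² × ℂ, and composed with the inclusion it
is a diffeomorphism to S³ followed by the immersion into ℝ⁴. -/
theorem injective_mfderiv_val (eL : Level Φ α c.ε ≃ₘ^∞⟮𝓡 (2 + 1), 𝓡 3⟯ S3)
    (heL : ∀ p, eL p = levelHomeo hΦ p)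
    (hval : ContMDiff (𝓡 (2 + 1)) ((𝓡 2).prod 𝓘(ℝ, ℂ)) ∞ (Subtype.val : Level Φ α c.ε → S2 × ℂ))
    (p : Level Φ α c.ε) :
    Injective (mfderiv (𝓡 (2 + 1)) ((𝓡 2).prod 𝓘(ℝ, ℂ))
      (Subtype.val : Level Φ α c.ε → S2 × ℂ) p) := by
  have h₁ : MDifferentiableAt ((𝓡 2).prod 𝓘(ℝ, ℂ)) 𝓘(ℝ, E4)
      (fun p : S2 × ℂ => c.coord p.1 p.2) p.1 :=
    (contMDiffAt_coord ((hΦ _ _).1 p.2).pos).mdifferentiableAt (by simp)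
  have h₂ := mfderiv_comp p h₁ (hval.mdifferentiable (by simp) p)
  have h₃ := mfderiv_comp p (I'' := 𝓘(ℝ, E4)) (g := (Subtype.val : S3 → E4)) (f := eL)
    ((contMDiff_coe_sphere (m := 1) (eL p)).mdifferentiableAt one_ne_zero)
    (eL.contMDiff.mdifferentiable (by simp) p)
  have h₄ : (fun p : S2 × ℂ => c.coord p.1 p.2) ∘ (Subtype.val : Level Φ α c.ε → S2 × ℂ) =
      (Subtype.val : S3 → E4) ∘ eL := funext fun p => by
    rw [comp_apply, comp_apply, heL]
    rfl
  rw [h₄, h₃] at h₂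
  have h₅ : Injective (mfderiv (𝓡 (2 + 1)) (𝓡 3) eL p) :=
    (eL.mfderivToContinuousLinearEquiv (by simp) p).injective
  intro v w hvw
  refine h₅ (incl3_injective (eL p) ?_)
  have h₆ (v) := congrArg (fun L : TangentSpace (𝓡 (2 + 1)) p →L[ℝ] E4 => L v) h₂
  exact (h₆ v).trans ((congrArg _ hvw).trans (h₆ w).symm)

variable [ChartedSpace (EuclideanSpace ℝ (Fin 2)) (CutSpace Φ α c.ε)]

theorem surjective_mfderiv_cutMk (eL : Level Φ α c.ε ≃ₘ^∞⟮𝓡 (2 + 1), 𝓡 3⟯ S3)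
    (eC : CutSpace Φ α c.ε ≃ₘ^∞⟮𝓡 2, 𝓡 2⟯ S2)
    (h : cutMk Φ α c.ε = eC.symm ∘ c.hopf ∘ eL) (p : Level Φ α c.ε) :
    Surjective (mfderiv (𝓡 (2 + 1)) (𝓡 2) (cutMk Φ α c.ε) p) := by
  have d₁ : MDifferentiable (𝓡 2) (𝓡 2) eC.symm := eC.symm.contMDiff.mdifferentiable (by simp)
  have d₂ : MDifferentiable (𝓡 3) (𝓡 2) c.hopf := c.contMDiff_hopf.mdifferentiable (by simp)
  have d₃ : MDifferentiable (𝓡 (2 + 1)) (𝓡 3) eL := eL.contMDiff.mdifferentiable (by simp)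
  rw [h, mfderiv_comp p (d₁ _) ((d₂ _).comp p (d₃ p)), mfderiv_comp p (d₂ _) (d₃ p)]
  have s₁ : Surjective (mfderiv (𝓡 2) (𝓡 2) eC.symm ((c.hopf ∘ eL) p)) :=
    (eC.symm.mfderivToContinuousLinearEquiv (by simp) _).surjective
  have s₃ : Surjective (mfderiv (𝓡 (2 + 1)) (𝓡 3) eL p) :=
    (eL.mfderivToContinuousLinearEquiv (by simp) p).surjective
  exact s₁.comp ((c.mfderiv_hopf_surjective (eL p)).comp s₃)

end Smooth

theorem exists_isReductionStructure
    (hΦ : ∀ (m : S2) (u : ℂ), Φ m - ((c.ε : ℤ) : ℝ) * ‖u‖ ^ 2 = α ↔ c.IsLevel m u) :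
    ∃ (_ : ChartedSpace (EuclideanSpace ℝ (Fin (2 + 1))) (Level Φ α c.ε))
      (_ : ChartedSpace (EuclideanSpace ℝ (Fin 2)) (CutSpace Φ α c.ε)),
      IsReductionStructure (d := 2) Φ α c.ε := by
  obtain ⟨cL, mL, hL, hL'⟩ := (levelHomeo hΦ).exists_chartedSpace_contMDiff (𝓡 (2 + 1)) ∞
  obtain ⟨cC, mC, hC, hC'⟩ := (cutHomeo hΦ).exists_chartedSpace_contMDiff (𝓡 2) ∞
  let eL : Level Φ α c.ε ≃ₘ^∞⟮𝓡 (2 + 1), 𝓡 3⟯ S3 := ⟨(levelHomeo hΦ).toEquiv, hL, hL'⟩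
  let eC : CutSpace Φ α c.ε ≃ₘ^∞⟮𝓡 2, 𝓡 2⟯ S2 := ⟨(cutHomeo hΦ).toEquiv, hC, hC'⟩
  have hval : ContMDiff (𝓡 (2 + 1)) ((𝓡 2).prod 𝓘(ℝ, ℂ)) ∞
      (Subtype.val : Level Φ α c.ε → S2 × ℂ) := by
    have h : (Subtype.val : Level Φ α c.ε → S2 × ℂ) = c.cap ∘ eL := funext fun p =>
      (congrArg Subtype.val ((levelHomeo hΦ).symm_apply_apply p)).symm
    rw [h]
    exact c.contMDiff_cap.comp hL
  have hcut : cutMk Φ α c.ε = eC.symm ∘ c.hopf ∘ eL := funext fun p =>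
    ((cutHomeo hΦ).symm_apply_apply _).symm
  have hcut' : ContMDiff (𝓡 (2 + 1)) (𝓡 2) ∞ (cutMk Φ α c.ε) := by
    rw [hcut]
    exact hC'.comp (c.contMDiff_hopf.comp hL)
  -- The complement ℝ accounts for one dimension in each case: 3 + 1 = 4 for the inclusion and 2 + 1
  -- = 3 for the quotient map.
  refine ⟨cL, cC, mL, mC, ⟨Manifold.IsImmersionOfComplement.isImmersion (F := ℝ) fun p => ?_,
    Topology.IsEmbedding.subtypeVal⟩,
    Manifold.IsSubmersionOfComplement.isSubmersion (F := ℝ) fun p => ?_⟩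
  · exact Manifold.isImmersionAtOfComplement_of_injective_mfderiv (by simp) hval
      (injective_mfderiv_val hΦ eL (fun _ => rfl) hval p) (by simp)
  · exact Manifold.isSubmersionAtOfComplement_of_surjective_mfderiv (by simp) hcut'
      (surjective_mfderiv_cutMk eL eC hcut p) (by simp)

theorem isSubmersion_hopf : Manifold.IsSubmersion (𝓡 3) (𝓡 2) ∞ c.hopf :=
  Manifold.IsSubmersionOfComplement.isSubmersion (F := ℝ) fun p =>
    Manifold.isSubmersionAtOfComplement_of_surjective_mfderiv (by simp) c.contMDiff_hopf
      (c.mfderiv_hopf_surjective p) (by simp)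

/-- Smoothness of the identification is tested on the level set through the submersion `cutMk`, and
that of its inverse on S³ through the submersion `hopf`. The form identity on S³ then descends, and
injectivity of the pullback along `cutMk` gives both directions of the equivalence. -/
theorem cutIdentifiedWith
    (hΦ : ∀ (m : S2) (u : ℂ), Φ m - ((c.ε : ℤ) : ℝ) * ‖u‖ ^ 2 = α ↔ c.IsLevel m u)
    {n : ℝ} (hn : 2 * c.K = c.sgn * n * c.s * c.R) :
    CutIdentifiedWith (omegaS2 n) Φ α c.ε (omegaS2 (n * c.R / 2)) := by
  refine ⟨exists_isReductionStructure hΦ, ?_⟩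
  intro cL cC hred
  have := hred.level_manifold
  have hL := contMDiff_levelHomeo hΦ hred.embedding.contMDiff
  have hL' := contMDiff_levelHomeo_symm hΦ hred.embedding
  let eL : Level Φ α c.ε ≃ₘ^∞⟮𝓡 (2 + 1), 𝓡 3⟯ S3 := ⟨(levelHomeo hΦ).toEquiv, hL, hL'⟩
  have hq : Surjective (cutMk Φ α c.ε) := Quotient.mk_surjective
  have hF : ContMDiff (𝓡 2) (𝓡 2) ∞ (cutEquiv hΦ) :=
    hred.submersion.contMDiff_of_comp hq (c.contMDiff_hopf.comp hL)
  have hF' : ContMDiff (𝓡 2) (𝓡 2) ∞ (cutEquiv hΦ).symm := by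
    refine isSubmersion_hopf.contMDiff_of_comp c.hopf_surjective ?_
    have h : (cutEquiv hΦ).symm ∘ c.hopf = cutMk Φ α c.ε ∘ (levelHomeo hΦ).symm := by
      funext y
      rw [comp_apply, comp_apply, Equiv.symm_apply_eq, cutEquiv_cutMk,
        Homeomorph.apply_symm_apply]
    rw [h]
    exact hred.submersion.contMDiff.comp hL'
  let F : CutSpace Φ α c.ε ≃ₘ^∞⟮𝓡 2, 𝓡 2⟯ S2 := ⟨cutEquiv hΦ, hF, hF'⟩
  have hcut : cutMk Φ α c.ε = F.symm ∘ c.hopf ∘ eL := funext fun p =>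
    ((cutEquiv hΦ).symm_apply_apply _).symm
  have hform : TwoForm.pullback (I := 𝓡 (2 + 1)) (Subtype.val : Level Φ α c.ε → S2 × ℂ)
      (sumForm (omegaS2 n)) = TwoForm.pullback (I := 𝓡 (2 + 1)) (cutMk Φ α c.ε)
        (TwoForm.pullback (I := 𝓡 2) F (omegaS2 (n * c.R / 2))) := by
    have h₁ : (Subtype.val : Level Φ α c.ε → S2 × ℂ) = c.cap ∘ eL := funext fun p =>
      (congrArg Subtype.val ((levelHomeo hΦ).symm_apply_apply p)).symm
    have h₂ : F ∘ cutMk Φ α c.ε = c.hopf ∘ eL := rfl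
    rw [← TwoForm.pullback_comp _ (F.contMDiff.mdifferentiable (by simp))
        (hred.submersion.contMDiff.mdifferentiable (by simp)), h₂, h₁,
      TwoForm.pullback_comp (I' := 𝓡 3) _ (c.contMDiff_cap.mdifferentiable (by simp))
        (eL.contMDiff.mdifferentiable (by simp)),
      TwoForm.pullback_comp (I' := 𝓡 3) _ (c.contMDiff_hopf.mdifferentiable (by simp))
        (eL.contMDiff.mdifferentiable (by simp)), c.pullback_cap_sumForm hn]
  refine ⟨F, cutEquiv_equivariant hΦ, fun η => ?_⟩
  rw [IsReducedForm, hform]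
  exact (TwoForm.pullback_injective hq (surjective_mfderiv_cutMk eL F hcut)).eq_iff

end Cap

/-! ### Application to the moment map. -/

/-- The cut of the sphere at an interior level of a moment map of slope `n / 2`, where the cap
around the pole `s` remains. -/
theorem cutIdentifiedWith_moment {k n ℓ : ℤ} {ε : ℤˣ} {s R : ℝ} (hs : s ^ 2 = 1) (hR : 0 < R)
    (hR₂ : R < 2) (hn : 0 < ((ε : ℤ) : ℝ) * n * s)
    (hℓ : (ℓ : ℝ) / 2 = n / 2 * (s * (1 - R) + 1) + k + 1 / 2) :
    CutIdentifiedWith (omegaS2 n) (moment k n) ((ℓ : ℝ) / 2) ε (omegaS2 (n * R / 2)) := by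
  -- The value of `K` is ε(Φ − α) at the pole s, and it is exactly the one that makes the forms
  -- proportional. Its positivity, from `hn`, says that the cap around s is the side where ε(Φ − α)
  -- ≥ 0.
  let c : Cap := ⟨s, R, ((ε : ℤ) : ℝ) * n * s * R / 2, ε, hs, hR, hR₂, by positivity⟩
  have hε := c.sgn_sq
  refine c.cutIdentifiedWith (fun m u => ?_) (by simp only [c, Cap.sgn]; ring)
  change ((ε : ℤ) : ℝ) ^ 2 = 1 at hε
  have h : c.IsLevel m u ↔
      ‖u‖ ^ 2 = ((ε : ℤ) : ℝ) * (n / 2 * ((m : E3) 2 - s * (1 - R))) := by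
    simp only [Cap.IsLevel, c]
    have e : ((ε : ℤ) : ℝ) * n * s * R / 2 / R * (R - 1 + s * (m : E3) 2) =
        ((ε : ℤ) : ℝ) * (n / 2 * ((m : E3) 2 - s * (1 - R))) := by
      field_simp
      linear_combination n * (m : E3) 2 * hs
    rw [e]
  rw [h, hℓ, moment]
  constructor
  · intro h
    linear_combination -((ε : ℤ) : ℝ) * h - ‖u‖ ^ 2 * hε
  · intro h
    linear_combination -((ε : ℤ) : ℝ) * h -
      (n / 2 * ((m : E3) 2 - s * (1 - R))) * hε

end SphereCut

end

/-- The level Φ = ℓ/2 lies at height z = r − 1. The positive cut keeps Φ ≥ ℓ/2, which is the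
northern cap for n > 0 and the southern one for n < 0; this is the source of the exchange. -/
theorem claim4p3 (k n ℓ : ℤ) :
    ((k : ℝ) + 1 / 2 < (ℓ : ℝ) / 2 → (ℓ : ℝ) / 2 < (n : ℝ) + k + 1 / 2 →
      SphereCut.CutIdentifiedWith (SphereCut.omegaS2 n) (SphereCut.moment k n) ((ℓ : ℝ) / 2) 1
          (SphereCut.omegaS2 ((k : ℝ) + n + (1 - ℓ) / 2)) ∧
        SphereCut.CutIdentifiedWith (SphereCut.omegaS2 n) (SphereCut.moment k n) ((ℓ : ℝ) / 2) (-1)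
          (SphereCut.omegaS2 (-(k : ℝ) + (ℓ - 1) / 2))) ∧
    ((n : ℝ) + k + 1 / 2 < (ℓ : ℝ) / 2 → (ℓ : ℝ) / 2 < (k : ℝ) + 1 / 2 →
      SphereCut.CutIdentifiedWith (SphereCut.omegaS2 n) (SphereCut.moment k n) ((ℓ : ℝ) / 2) 1
          (SphereCut.omegaS2 (-(k : ℝ) + (ℓ - 1) / 2)) ∧
        SphereCut.CutIdentifiedWith (SphereCut.omegaS2 n) (SphereCut.moment k n) ((ℓ : ℝ) / 2) (-1)
          (SphereCut.omegaS2 ((k : ℝ) + n + (1 - ℓ) / 2))) := by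
  -- The heights of the southern and of the northern cap.
  set r : ℝ := (ℓ - 2 * k - 1) / n with hr
  have key (hn : (n : ℝ) ≠ 0) : (n : ℝ) * r = ℓ - 2 * k - 1 := mul_div_cancel₀ _ hn
  have hN (hn : (n : ℝ) ≠ 0) : (k : ℝ) + n + (1 - ℓ) / 2 = n * (2 - r) / 2 := by
    linear_combination key hn / 2
  have hS (hn : (n : ℝ) ≠ 0) : -(k : ℝ) + (ℓ - 1) / 2 = n * r / 2 := by
    linear_combination -key hn / 2
  constructor
  · intro h₁ h₂
    have hn : (0 : ℝ) < n := by linarith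
    have hr₀ : 0 < r := div_pos (by linarith) hn
    have hr₂ : r < 2 := (div_lt_iff₀ hn).2 (by linarith)
    rw [hN hn.ne', hS hn.ne']
    constructor
    · exact SphereCut.cutIdentifiedWith_moment (s := 1) (by norm_num) (by linarith) (by linarith)
        (by simpa using hn) (by linear_combination -key hn.ne' / 2)
    · exact SphereCut.cutIdentifiedWith_moment (s := -1) (by norm_num) hr₀ hr₂
        (by simpa using hn) (by linear_combination -key hn.ne' / 2)
  · intro h₁ h₂
    have hn : (n : ℝ) < 0 := by linarith
    have hr₀ : 0 < r := div_pos_of_neg_of_neg (by linarith) hn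
    have hr₂ : r < 2 := (div_lt_iff_of_neg hn).2 (by linarith)
    rw [hN hn.ne, hS hn.ne]
    constructor
    · exact SphereCut.cutIdentifiedWith_moment (s := -1) (by norm_num) hr₀ hr₂
        (by simpa using hn) (by linear_combination -key hn.ne / 2)
    · exact SphereCut.cutIdentifiedWith_moment (s := 1) (by norm_num) (by linarith) (by linarith)
        (by simpa using hn) (by linear_combination -key hn.ne / 2)
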